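/- Let $d\ge 2$ and $1\le p<d$, and let $w\in\mathcal A_p(\mathbb R^d)$ be a Muckenhoupt weight, that is, $w\in L^1_{\mathrm{loc}}(\mathbb R^d)$, $w>0$ almost everywhere, and there is a constant $C$ such that for every ball $B$ $$\Big(\frac1{|B|}\int_B w\,dx\Big)\Big(\frac1{|B|}\int_B w^{-\frac1{p-1}}\,dx\Big)^{p-1}\le C\quad\text{if }p>1,\qquad \frac1{|B|}\int_B w\,dx\le C\,w(y)\ \text{ for a.e. } y\in B\quad\text{if }p=1.$$ Write $d\mu=w\,dx$ and $w(A)=\int_A w\,dx$. Let $\dot W^{1,p}(\mathbb R^d,w)$ be the space of all $u\in L^p_{\mathrm{loc}}(\mathbb R^d,w)$ whose distributional gradient satisfies $|\nabla u|\in L^p(\mathbb R^d,w)$, each $u$ being represented by its Lebesgue representative $u(x)=\limsup_{r\to0^+}\frac1{|B(x,r)|}\int_{B(x,r)}u(y)\,dy$. Cubes are $Q=\prod_{i=1}^d[x_i-\ell/2,x_i+\ell/2]$ with $x\in\mathbb R^d$ and edge length $\ell(Q)=\ell>0$. For a sequence of cubes, $Q_i\to\infty$ means that for every $R>0$ there is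 an $N$ with $B(0,R)\cap Q_i=\emptyset$ for all $i\ge N$. The following two conditions are equivalent: 1. $\displaystyle\inf_{\ell(Q)=1}w(Q)>0$. 2. For every $u\in\dot W^{1,p}(\mathbb R^d,w)$ there exists a unique constant $c\in\mathbb R$ such that for every sequence of cubes $Q_i\subset\mathbb R^d$ with $\liminf_{i\to\infty}\ell(Q_i)>0$ and $Q_i\to\infty$, $$\lim_{i\to\infty}\frac1{w(Q_i)}\int_{Q_i}u\,d\mu=c.$$ Moreover, when these conditions hold, the constant $c$ of condition 2 is the unique almost sure radial limit of $u$: $\lim_{t\to\infty}u(t\xi)=c$ for almost every $\xi$ in the unit sphere $\mathbb S^{d-1}$, with respect to surface measure. -/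

import Mathlib

open MeasureTheory Filter Topology Set
open scoped ENNReal NNReal ContDiff

namespace MuckenhouptLimits

noncomputable section

/-- The weighted measure `μ` with `dμ = w dx`. -/
def weightedMeasure {d : ℕ} (w : EuclideanSpace ℝ (Fin d) → ℝ) :
    Measure (EuclideanSpace ℝ (Fin d)) :=
  volume.withDensity fun x => ENNReal.ofReal (w x)

/-- The Muckenhoupt class `A_p(ℝ^d)`, `1 ≤ p < ∞`: locally integrable, almost everywhere positive
weights that satisfy the `A_p`-condition on all balls. The averages are taken in `[0, ∞]`, so that
the condition contains the finiteness of the second average. -/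
structure IsMuckenhoupt {d : ℕ} (p : ℝ) (w : EuclideanSpace ℝ (Fin d) → ℝ) : Prop where
  locallyIntegrable : LocallyIntegrable w volume
  pos : ∀ᵐ x, 0 < w x
  one_bound : p = 1 → ∃ C : ℝ≥0, ∀ (x : EuclideanSpace ℝ (Fin d)) (r : ℝ), 0 < r →
    ∀ᵐ y, y ∈ Metric.ball x r →
      (⨍⁻ z in Metric.ball x r, ENNReal.ofReal (w z) ∂volume) ≤ C * ENNReal.ofReal (w y)
  bound : 1 < p → ∃ C : ℝ≥0, ∀ (x : EuclideanSpace ℝ (Fin d)) (r : ℝ), 0 < r →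
    (⨍⁻ z in Metric.ball x r, ENNReal.ofReal (w z) ∂volume) *
      (⨍⁻ z in Metric.ball x r, ENNReal.ofReal (w z) ^ (-(1 / (p - 1))) ∂volume) ^ (p - 1) ≤ C

/-- `g` is the distributional gradient of the locally integrable function `u`. -/
structure HasWeakGradient {d : ℕ} (u : EuclideanSpace ℝ (Fin d) → ℝ)
    (g : EuclideanSpace ℝ (Fin d) → EuclideanSpace ℝ (Fin d)) : Prop where
  locallyIntegrable : LocallyIntegrable u volume
  locallyIntegrable_grad : LocallyIntegrable g volume
  integral_eq : ∀ φ : EuclideanSpace ℝ (Fin d) → ℝ, ContDiff ℝ ∞ φ → HasCompactSupport φ →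
    ∀ i : Fin d,
      ∫ x, u x * fderiv ℝ φ x (EuclideanSpace.single i 1) = -∫ x, g x i * φ x

/-- The homogeneous weighted Sobolev space `Ẇ^{1,p}(ℝ^d, w)`, as a set of functions (all
representatives are admitted; see `lebesgueRep`): `u` is locally in `L^p(w)` and its distributional
gradient is in `L^p(ℝ^d, w)`. -/
structure MemHomSobolev {d : ℕ} (p : ℝ) (w u : EuclideanSpace ℝ (Fin d) → ℝ) : Prop where
  memLp_loc : ∀ K : Set (EuclideanSpace ℝ (Fin d)), IsCompact K →
    MemLp u (ENNReal.ofReal p) ((weightedMeasure w).restrict K)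
  exists_grad : ∃ g : EuclideanSpace ℝ (Fin d) → EuclideanSpace ℝ (Fin d),
    HasWeakGradient u g ∧ MemLp g (ENNReal.ofReal p) (weightedMeasure w)

/-- The Lebesgue representative `x ↦ limsup_{r → 0+} ⨍_{B(x,r)} u dy`, the averages being taken with
respect to Lebesgue measure; the upper limit is an extended real number. -/
def lebesgueRep {d : ℕ} (u : EuclideanSpace ℝ (Fin d) → ℝ) (x : EuclideanSpace ℝ (Fin d)) : EReal :=
  limsup (fun r : ℝ => ((⨍ y in Metric.ball x r, u y ∂volume : ℝ) : EReal)) (𝓝[>] 0)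

/-- `c` is the unique almost sure radial limit of (the Lebesgue representative of) `u`:
`u(tξ) → c` as `t → ∞` for almost every `ξ` in the unit sphere, for the surface measure. -/
def HasRadialLimit {d : ℕ} (u : EuclideanSpace ℝ (Fin d) → ℝ) (c : ℝ) : Prop :=
  ∀ᵐ ξ : Metric.sphere (0 : EuclideanSpace ℝ (Fin d)) 1
    ∂(volume : Measure (EuclideanSpace ℝ (Fin d))).toSphere,
    Tendsto (fun t : ℝ => lebesgueRep u (t • (ξ : EuclideanSpace ℝ (Fin d)))) atTop (𝓝 (c : EReal))

/-- The closed axis-parallel cube `Q(x, ℓ) = ∏ [x_i - ℓ/2, x_i + ℓ/2]`. -/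
def cube {d : ℕ} (x : EuclideanSpace ℝ (Fin d)) (l : ℝ) : Set (EuclideanSpace ℝ (Fin d)) :=
  {y | ∀ i, y i ∈ Icc (x i - l / 2) (x i + l / 2)}

/-- `Q_i → ∞`: the sets `Q_i` eventually leave every ball centred at the origin. -/
def TendstoInfinity {d : ℕ} (Q : ℕ → Set (EuclideanSpace ℝ (Fin d))) : Prop :=
  ∀ R : ℝ, 0 < R → ∃ N : ℕ, ∀ i ≥ N, Metric.ball 0 R ∩ Q i = ∅

/-- `c` is the limit of the weighted averages `⨍_{Q_i} u dμ` along all sequences of cubes with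
`Q_i → ∞` and `liminf ℓ(Q_i) > 0` (the lower limit is taken in `[0, ∞]`). -/
def HasCubeLimit {d : ℕ} (w u : EuclideanSpace ℝ (Fin d) → ℝ) (c : ℝ) : Prop :=
  ∀ (x : ℕ → EuclideanSpace ℝ (Fin d)) (l : ℕ → ℝ), (∀ i, 0 < l i) →
    0 < liminf (fun i => ENNReal.ofReal (l i)) atTop →
    TendstoInfinity (fun i => cube (x i) (l i)) →
    Tendsto (fun i => ⨍ y in cube (x i) (l i), u y ∂(weightedMeasure w)) atTop (𝓝 c)

end

end MuckenhouptLimits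

/-!
The weight enters through one inequality, which is the `A_p`-condition combined with Hölder's
inequality: `(∫_B f dx)^p μ(B) ≤ C |B|^p ∫_B f^p dμ` for all balls `B` and all `f ≥ 0`
(`IsMuckenhoupt.exists_lintegral_rpow_mul_le`). In particular `μ` is doubling.

*Sufficiency of the lower bound on unit cubes.* The bound gives `μ(B) ≥ a r^d` for the balls of
radius `r ≥ δ`, so that the inequality above becomes
`∫_B f dx ≤ C r^{d - d/p} (∫_B f^p dμ)^{1/p}`, as for Lebesgue measure
(`IsMuckenhoupt.exists_setLIntegral_le`). The only property of `u` that is used afterwards is an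
estimate of its increments under the dilations `y ↦ z + λ(y - z)` by line integrals of the gradient
(`HasWeakGradient.setLIntegral_enorm_dilation_sub_le`, recorded for averages as `DilationBound`).
Two balls, one of which contains the other, are related by a dilation, so their averages differ by
at most `C r^{1 - d/p} ‖∇u‖_{L^p(μ)}` when the radii are comparable to `r`. As `p < d`, this is
summable along dyadic radii, and the averages over large balls have a limit `c`. Since moreover the
gradient has small norm far away from the origin, the averages over balls of fixed radius tend to
`c` as the centre tends to infinity (`DilationBound.exists_tendsto_ballAverage`).

To pass to the averages over cubes for `μ`, `u` is compared with its averages over balls of radius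
`δ`: telescoping over the radii `2^{-j} δ`, together with the boundedness of averaging operators on
`L^p(μ)` that the `A_p`-condition provides (`IsMuckenhoupt.exists_setLIntegral_average_le`), gives a
Poincaré inequality `∫_Q |u - u_δ| dμ ≤ C μ(Q)^{1 - 1/p} (∫_{Q_δ} |∇u|^p dμ)^{1/p}`, where `Q_δ` is
the `δ`-neighbourhood of `Q` (`DilationBound.exists_setLIntegral_enorm_sub_le`). After division by
`μ(Q)`, which is bounded below, the right-hand side tends to zero as `Q → ∞`
(`DilationBound.hasCubeLimit`).

For the radial limits, dilations centred at the origin show that the average of `u` over a small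
ball about a point far away differs from `c` by at most the average of the function `F` that
integrates the gradient along the rays outside a large ball. This `F` is homogeneous of degree zero,
and it is locally integrable since `∫_1^∞ s^{-d/p} ds < ∞`. At its Lebesgue points `F` therefore
bounds the upper and lower limits of the averages of `u` along the whole ray, and `F` tends to zero
almost everywhere as the removed ball grows (`DilationBound.hasRadialLimit`).

*Necessity.* If unit cubes have arbitrarily small mass, they do so arbitrarily far away. The sum of
bump functions at sparse cubes with summable masses lies in the Sobolev space, but its averages are
`1` over these cubes and `0` over others (`IsMuckenhoupt.iInf_measure_cube_pos`).
-/

namespace MuckenhouptLimits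

/-! ### Muckenhoupt weights -/

section

variable {d : ℕ} {p : ℝ} {w : EuclideanSpace ℝ (Fin d) → ℝ}

theorem IsMuckenhoupt.aemeasurable (hw : IsMuckenhoupt p w) :
    AEMeasurable (fun x => ENNReal.ofReal (w x)) volume :=
  hw.locallyIntegrable.aestronglyMeasurable.aemeasurable.ennreal_ofReal

theorem IsMuckenhoupt.setLIntegral_eq (hw : IsMuckenhoupt p w)
    {s : Set (EuclideanSpace ℝ (Fin d))} (hs : MeasurableSet s)
    (f : EuclideanSpace ℝ (Fin d) → ℝ≥0∞) :
    ∫⁻ x in s, f x ∂(weightedMeasure w) = ∫⁻ x in s, ENNReal.ofReal (w x) * f x := by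
  rw [weightedMeasure, setLIntegral_withDensity_eq_setLIntegral_mul_non_measurable₀ _
    hw.aemeasurable.restrict _ hs (Eventually.of_forall fun _ => ENNReal.ofReal_lt_top)]
  rfl

theorem weightedMeasure_apply {s : Set (EuclideanSpace ℝ (Fin d))} (hs : MeasurableSet s) :
    weightedMeasure w s = ∫⁻ x in s, ENNReal.ofReal (w x) := by
  rw [weightedMeasure, withDensity_apply _ hs]

theorem weightedMeasure_absolutelyContinuous (w : EuclideanSpace ℝ (Fin d) → ℝ) :
    weightedMeasure w ≪ volume :=
  withDensity_absolutelyContinuous _ _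

theorem IsMuckenhoupt.absolutelyContinuous (hw : IsMuckenhoupt p w) :
    volume ≪ weightedMeasure w := by
  refine withDensity_absolutelyContinuous' hw.aemeasurable ?_
  filter_upwards [hw.pos] with x hx
  simpa using hx

instance (w : EuclideanSpace ℝ (Fin d) → ℝ) : SFinite (weightedMeasure w) := by
  unfold weightedMeasure; infer_instance

theorem IsMuckenhoupt.measure_lt_top (hw : IsMuckenhoupt p w)
    {s : Set (EuclideanSpace ℝ (Fin d))} (hs : Bornology.IsBounded s) :
    weightedMeasure w s < ⊤ := by
  refine (measure_mono (subset_closure (s := s))).trans_lt ?_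
  rw [weightedMeasure_apply isClosed_closure.measurableSet]
  exact (hw.locallyIntegrable.integrableOn_isCompact hs.isCompact_closure).lintegral_lt_top

theorem IsMuckenhoupt.measure_ball_pos (hw : IsMuckenhoupt p w) (x : EuclideanSpace ℝ (Fin d))
    {r : ℝ} (hr : 0 < r) : 0 < weightedMeasure w (Metric.ball x r) := by
  refine pos_iff_ne_zero.2 fun h => ?_
  exact (Metric.measure_ball_pos volume x hr).ne' (hw.absolutelyContinuous h)

/-- The form of the `A_p`-condition on which everything rests, valid for all `p ≥ 1`. It follows
from Hölder's inequality applied to `f = (f w^{1/p}) w^{-1/p}` if `p > 1`. -/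
theorem IsMuckenhoupt.exists_lintegral_rpow_mul_le (hp : 1 ≤ p) (hw : IsMuckenhoupt p w) :
    ∃ C : ℝ≥0, ∀ (x : EuclideanSpace ℝ (Fin d)) (r : ℝ), 0 < r →
      ∀ f : EuclideanSpace ℝ (Fin d) → ℝ≥0∞, AEMeasurable f volume →
      (∫⁻ z in Metric.ball x r, f z) ^ p * weightedMeasure w (Metric.ball x r) ≤
        C * volume (Metric.ball x r) ^ p *
          ∫⁻ z in Metric.ball x r, f z ^ p ∂(weightedMeasure w) := by
  rcases hp.eq_or_lt with rfl | hp1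
  · obtain ⟨C, hC⟩ := hw.one_bound rfl
    refine ⟨C, fun x r hr f hf => ?_⟩
    have hV0 : volume (Metric.ball x r) ≠ 0 := (Metric.measure_ball_pos volume x hr).ne'
    have hV : volume (Metric.ball x r) ≠ ⊤ := measure_ball_lt_top.ne
    have hμ : weightedMeasure w (Metric.ball x r) =
        volume (Metric.ball x r) * ⨍⁻ z in Metric.ball x r, ENNReal.ofReal (w z) ∂volume := by
      rw [setLAverage_eq, ENNReal.mul_div_cancel hV0 hV, weightedMeasure_apply measurableSet_ball]
    simp only [ENNReal.rpow_one]
    rw [hw.setLIntegral_eq measurableSet_ball, hμ, mul_left_comm, mul_comm (C : ℝ≥0∞), mul_assoc]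
    refine mul_le_mul_right ?_ _
    rw [← lintegral_mul_const'' _ hf.restrict, ← lintegral_const_mul' _ _ ENNReal.coe_ne_top]
    refine lintegral_mono_ae ?_
    filter_upwards [ae_restrict_of_ae (hC x r hr), ae_restrict_mem measurableSet_ball] with y h1 h2
    calc _ ≤ f y * (C * ENNReal.ofReal (w y)) := by gcongr; exact h1 h2
      _ = _ := by ring
  · obtain ⟨C, hC⟩ := hw.bound hp1
    refine ⟨C, fun x r hr f hf => ?_⟩
    have hV0 : volume (Metric.ball x r) ≠ 0 := (Metric.measure_ball_pos volume x hr).ne'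
    have hV : volume (Metric.ball x r) ≠ ⊤ := measure_ball_lt_top.ne
    have hp0 : 0 < p := by linarith
    have hq := Real.HolderConjugate.conjExponent hp1
    set q := p.conjExponent with hqdef
    set V := volume (Metric.ball x r)
    set W := ∫⁻ z in Metric.ball x r, ENNReal.ofReal (w z) with hW
    set S := ∫⁻ z in Metric.ball x r, ENNReal.ofReal (w z) ^ (-(1 / (p - 1)))
    have hWS : W * S ^ (p - 1) ≤ C * V ^ p := by
      have h := hC x r hr
      rw [setLAverage_eq, setLAverage_eq, ENNReal.div_rpow_of_nonneg _ _ (by linarith)] at h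
      calc W * S ^ (p - 1) = (W / V * (S ^ (p - 1) / V ^ (p - 1))) * (V * V ^ (p - 1)) := by
            have hVp0 : V ^ (p - 1) ≠ 0 := by simp [hV0, hV]
            have hVp : V ^ (p - 1) ≠ ⊤ := by simp [hV0, hV]
            rw [mul_mul_mul_comm, ENNReal.div_mul_cancel hV0 hV, ENNReal.div_mul_cancel hVp0 hVp]
        _ ≤ C * V ^ p := by
            refine mul_le_mul' h (le_of_eq ?_)
            nth_rewrite 1 [← ENNReal.rpow_one V]
            rw [← ENNReal.rpow_add _ _ hV0 hV]
            congr 1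
            ring
    -- Hölder's inequality, with conjugate exponents `p` and `q = p / (p - 1)`
    have hH : ∫⁻ z in Metric.ball x r, f z ≤
        (∫⁻ z in Metric.ball x r, ENNReal.ofReal (w z) * f z ^ p) ^ (1 / p) * S ^ (1 / q) := by
      have h := ENNReal.lintegral_mul_le_Lp_mul_Lq (volume.restrict (Metric.ball x r)) hq
        (f := fun z => ENNReal.ofReal (w z) ^ (1 / p) * f z)
        (g := fun z => ENNReal.ofReal (w z) ^ (-(1 / p)))
        ((hw.aemeasurable.restrict.pow_const _).mul hf.restrict)
        (hw.aemeasurable.restrict.pow_const _)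
      refine (lintegral_mono_ae ?_).trans (h.trans ?_)
      · filter_upwards [ae_restrict_of_ae hw.pos] with z hz
        have h1 : ENNReal.ofReal (w z) ≠ 0 := by simpa using hz
        simp only [Pi.mul_apply]
        rw [mul_right_comm, ← ENNReal.rpow_add _ _ h1 ENNReal.ofReal_ne_top]
        simp
      · refine mul_le_mul' (le_of_eq ?_) (le_of_eq ?_)
        · congr 1
          refine lintegral_congr fun z => ?_
          rw [ENNReal.mul_rpow_of_nonneg _ _ hp0.le, ← ENNReal.rpow_mul]
          field_simp
          simp
        · congr 1
          refine lintegral_congr fun z => ?_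
          rw [← ENNReal.rpow_mul]
          congr 1
          rw [hqdef, Real.conjExponent]
          field_simp
    rw [hw.setLIntegral_eq measurableSet_ball, weightedMeasure_apply measurableSet_ball, ← hW]
    calc _ ≤ ((∫⁻ z in Metric.ball x r, ENNReal.ofReal (w z) * f z ^ p) ^ (1 / p) *
            S ^ (1 / q)) ^ p * W := by gcongr
      _ = (∫⁻ z in Metric.ball x r, ENNReal.ofReal (w z) * f z ^ p) * (W * S ^ (p - 1)) := by
        rw [ENNReal.mul_rpow_of_nonneg _ _ hp0.le, ← ENNReal.rpow_mul, ← ENNReal.rpow_mul,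
          one_div_mul_cancel hp0.ne', ENNReal.rpow_one]
        have : 1 / q * p = p - 1 := by
          rw [hqdef, Real.conjExponent]
          have : p - 1 ≠ 0 := by linarith
          field_simp
        rw [this]
        ring
      _ ≤ _ := by
        rw [mul_comm]
        gcongr

/-- Doubling: apply `IsMuckenhoupt.exists_lintegral_rpow_mul_le` on the large ball to the indicator
function of the small one. -/
theorem IsMuckenhoupt.exists_measure_ball_le (hp : 1 ≤ p) (hw : IsMuckenhoupt p w) {M : ℝ}
    (hM : 0 < M) :
    ∃ C : ℝ≥0, ∀ (x y : EuclideanSpace ℝ (Fin d)) (r : ℝ), 0 < r →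
      Metric.ball x r ⊆ Metric.ball y (M * r) →
      weightedMeasure w (Metric.ball y (M * r)) ≤ C * weightedMeasure w (Metric.ball x r) := by
  obtain ⟨C, hC⟩ := hw.exists_lintegral_rpow_mul_le hp
  refine ⟨C * Real.toNNReal (M ^ d) ^ p, fun x y r hr hsub => ?_⟩
  have hp0 : 0 ≤ p := by linarith
  have h := hC y (M * r) (by positivity) ((Metric.ball x r).indicator 1)
    (aemeasurable_one.indicator measurableSet_ball)
  have hV0 : volume (Metric.ball x r) ≠ 0 := (Metric.measure_ball_pos volume x hr).ne'
  have hV : volume (Metric.ball x r) ≠ ⊤ := measure_ball_lt_top.ne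
  have e1 : ∫⁻ z in Metric.ball y (M * r), (Metric.ball x r).indicator 1 z =
      volume (Metric.ball x r) := by
    rw [lintegral_indicator_one measurableSet_ball, Measure.restrict_apply measurableSet_ball,
      inter_eq_left.2 hsub]
  have e2 : ∫⁻ z in Metric.ball y (M * r), (Metric.ball x r).indicator 1 z ^ p
      ∂(weightedMeasure w) = weightedMeasure w (Metric.ball x r) := by
    have : ∀ z, ((Metric.ball x r).indicator (1 : EuclideanSpace ℝ (Fin d) → ℝ≥0∞) z) ^ p =
        (Metric.ball x r).indicator 1 z := by
      intro z
      by_cases hz : z ∈ Metric.ball x r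
      · simp [hz]
      · simp [hz, show 0 < p by linarith]
    simp_rw [this]
    rw [lintegral_indicator_one measurableSet_ball, Measure.restrict_apply measurableSet_ball,
      inter_eq_left.2 hsub]
  have e3 : volume (Metric.ball y (M * r)) = Real.toNNReal (M ^ d) * volume (Metric.ball x r) := by
    rw [Measure.addHaar_ball_mul_of_pos _ _ hM, Measure.addHaar_ball_center volume x r]
    simp [ENNReal.ofReal]
  rw [e1, e2, e3, ENNReal.mul_rpow_of_nonneg _ _ hp0] at h
  have hVp0 : volume (Metric.ball x r) ^ p ≠ 0 := by simp [hV0, hV]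
  have hVp : volume (Metric.ball x r) ^ p ≠ ⊤ := by simp [hV0, hV]
  rw [← ENNReal.mul_le_mul_iff_right hVp0 hVp]
  refine h.trans_eq ?_
  push_cast
  rw [ENNReal.coe_rpow_of_nonneg _ hp0]
  ring

theorem measurableSet_cube (x : EuclideanSpace ℝ (Fin d)) (l : ℝ) : MeasurableSet (cube x l) := by
  have : cube x l = ⋂ i, {y | y i ∈ Icc (x i - l / 2) (x i + l / 2)} := by
    ext; simp [cube]
  rw [this]
  refine MeasurableSet.iInter fun i => ?_
  have : Measurable fun y : EuclideanSpace ℝ (Fin d) => y i := by fun_prop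
  exact this measurableSet_Icc

theorem ball_subset_cube (x : EuclideanSpace ℝ (Fin d)) (l : ℝ) :
    Metric.ball x (l / 2) ⊆ cube x l := by
  intro y hy i
  have h1 : |y i - x i| ≤ ‖y - x‖ := by
    simpa using PiLp.norm_apply_le (y - x) i
  rw [Metric.mem_ball, dist_eq_norm] at hy
  have h2 := abs_le.1 (h1.trans hy.le)
  constructor <;> linarith [h2.1, h2.2]

theorem dist_le_of_mem_cube {x y : EuclideanSpace ℝ (Fin d)} {l : ℝ} (hl : 0 ≤ l)
    (h : y ∈ cube x l) : dist y x ≤ d * (l / 2) := by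
  rw [EuclideanSpace.dist_eq, Real.sqrt_le_left (by positivity)]
  calc ∑ i, dist (y i) (x i) ^ 2 ≤ ∑ _i : Fin d, (l / 2) ^ 2 := by
        refine Finset.sum_le_sum fun i _ => ?_
        have := h i
        rw [Real.dist_eq, sq_abs]
        refine sq_le_sq' ?_ ?_ <;> linarith [this.1, this.2]
    _ = d * (l / 2) ^ 2 := by simp
    _ ≤ _ := by
        rw [mul_pow]
        gcongr
        exact_mod_cast Nat.le_self_pow two_ne_zero d

theorem isCompact_cube (x : EuclideanSpace ℝ (Fin d)) (l : ℝ) : IsCompact (cube x l) := by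
  have hc : IsClosed (cube x l) := by
    have : cube x l = ⋂ i, {y | y i ∈ Icc (x i - l / 2) (x i + l / 2)} := by
      ext; simp [cube]
    rw [this]
    refine isClosed_iInter fun i => ?_
    exact isClosed_Icc.preimage (by fun_prop : Continuous fun y : EuclideanSpace ℝ (Fin d) => y i)
  rcases lt_or_ge l 0 with hl | hl
  · rcases isEmpty_or_nonempty (Fin d) with h | ⟨⟨i⟩⟩
    · have : Subsingleton (EuclideanSpace ℝ (Fin d)) := ⟨fun a b => by ext i; exact h.elim i⟩
      exact (Set.toFinite _).isCompact
    · convert isCompact_empty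
      refine eq_empty_of_forall_notMem fun y hy => ?_
      have := hy i
      linarith [this.1, this.2]
  · refine Metric.isCompact_of_isClosed_isBounded hc ?_
    exact Metric.isBounded_closedBall.subset
      (fun y hy => Metric.mem_closedBall.2 (dist_le_of_mem_cube hl hy))

theorem volume_cube_one (x : EuclideanSpace ℝ (Fin d)) : volume (cube x 1) = 1 := by
  have h := EuclideanSpace.volume_preserving_symm_measurableEquiv_toLp (Fin d)
  have e : cube x 1 = (MeasurableEquiv.toLp 2 (Fin d → ℝ)).symm ⁻¹'
      (Icc (fun i => x i - 1 / 2) (fun i => x i + 1 / 2)) := by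
    ext y
    simp [cube, Pi.le_def, forall_and]
  rw [e, h.measure_preimage measurableSet_Icc.nullMeasurableSet, Real.volume_Icc_pi]
  have : ∀ i, x i + 1 / 2 - (x i - 1 / 2) = 1 := fun i => by ring
  simp_rw [this]
  simp

theorem mem_cube_comm {x y : EuclideanSpace ℝ (Fin d)} {l : ℝ} :
    y ∈ cube x l ↔ x ∈ cube y l := by
  refine forall_congr' fun i => ?_
  constructor <;> rintro ⟨h1, h2⟩ <;> constructor <;> linarith

/-- If unit cubes have mass at least `a`, then, by averaging `μ(cube y 1)` over `y ∈ B(x, ρ)`, large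
balls have density at least `a`. -/
theorem mul_volume_ball_le (a : ℝ≥0∞) (ha : ∀ x, a ≤ weightedMeasure w (cube x 1))
    (x : EuclideanSpace ℝ (Fin d)) (ρ : ℝ) :
    a * volume (Metric.ball x ρ) ≤ weightedMeasure w (Metric.ball x (ρ + d)) := by
  have hmeas : MeasurableSet {z : EuclideanSpace ℝ (Fin d) × EuclideanSpace ℝ (Fin d) |
      z.2 ∈ cube z.1 1} := by
    have : {z : EuclideanSpace ℝ (Fin d) × EuclideanSpace ℝ (Fin d) | z.2 ∈ cube z.1 1} =
        ⋂ i, {z | z.2 i - z.1 i ∈ Icc (- (1 / 2) : ℝ) (1 / 2)} := by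
      ext z
      simp only [cube, mem_ofPred_eq, mem_iInter, mem_Icc]
      refine forall_congr' fun i => ?_
      constructor <;> rintro ⟨h1, h2⟩ <;> constructor <;> linarith
    rw [this]
    refine MeasurableSet.iInter fun i => ?_
    exact (by fun_prop : Measurable fun z : EuclideanSpace ℝ (Fin d) × EuclideanSpace ℝ (Fin d) =>
      z.2 i - z.1 i) measurableSet_Icc
  calc a * volume (Metric.ball x ρ)
      ≤ ∫⁻ y in Metric.ball x ρ, weightedMeasure w (cube y 1) := by
        rw [← setLIntegral_const]
        exact lintegral_mono fun y => ha y
    _ = ∫⁻ y in Metric.ball x ρ, ∫⁻ z, (cube y 1).indicator 1 z ∂(weightedMeasure w) := by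
        simp_rw [lintegral_indicator_one (measurableSet_cube _ _)]
    _ = ∫⁻ z, (∫⁻ y in Metric.ball x ρ, (cube y 1).indicator 1 z) ∂(weightedMeasure w) := by
        refine lintegral_lintegral_swap (Measurable.aemeasurable ?_)
        exact measurable_one.indicator hmeas
    _ ≤ ∫⁻ z, (Metric.ball x (ρ + d)).indicator 1 z ∂(weightedMeasure w) := by
        refine lintegral_mono (fun z => ?_)
        by_cases hz : z ∈ Metric.ball x (ρ + d)
        · rw [indicator_of_mem hz, Pi.one_apply, ← volume_cube_one z,
            ← lintegral_indicator_one (measurableSet_cube z 1)]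
          have (y : EuclideanSpace ℝ (Fin d)) :
              (cube y 1).indicator (1 : EuclideanSpace ℝ (Fin d) → ℝ≥0∞) z =
                (cube z 1).indicator 1 y := by
            by_cases h : z ∈ cube y 1
            · simp [h, mem_cube_comm.1 h]
            · simp [h, mt mem_cube_comm.2 h]
          simp_rw [this]
          exact setLIntegral_le_lintegral _ _
        · refine le_of_eq_of_le (setLIntegral_eq_zero measurableSet_ball ?_) (zero_le (α := ℝ≥0∞))
          intro y hy
          refine indicator_of_notMem (fun h => hz ?_) _
          have h1 := dist_le_of_mem_cube zero_le_one h
          have h2 : (d : ℝ) * (1 / 2) ≤ d := by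
            have : (0 : ℝ) ≤ d := by positivity
            linarith
          have h3 := Metric.mem_ball.1 hy
          rw [Metric.mem_ball]
          linarith [dist_triangle z y x]
    _ = _ := lintegral_indicator_one measurableSet_ball

/-- If unit cubes have mass bounded below, then the density of `μ` is bounded below on all balls of
radius at least `δ`. -/
theorem IsMuckenhoupt.exists_le_measure_ball (hp : 1 ≤ p) (hw : IsMuckenhoupt p w)
    (h : 0 < ⨅ x, weightedMeasure w (cube x 1)) {δ : ℝ} (hδ : 0 < δ) :
    ∃ a : ℝ≥0, 0 < a ∧ ∀ (x : EuclideanSpace ℝ (Fin d)) (r : ℝ), δ ≤ r →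
      a * volume (Metric.ball x r) ≤ weightedMeasure w (Metric.ball x r) := by
  obtain ⟨a, ha0, ha⟩ := ENNReal.lt_iff_exists_nnreal_btwn.1 h
  have ha0 : 0 < a := by exact_mod_cast ha0
  have hM : (0 : ℝ) < d / δ + 1 := by positivity
  -- unit cubes centred in `B(x, r)` lie within `r + d ≤ (d / δ + 1) r` of `x`
  obtain ⟨C, hC⟩ := hw.exists_measure_ball_le hp hM
  refine ⟨a / (C + 1), by positivity, fun x r hr => ?_⟩
  have hr0 : 0 < r := hδ.trans_le hr
  have h1 : (d : ℝ) ≤ d / δ * r := by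
    rw [div_mul_eq_mul_div, le_div_iff₀ hδ]
    gcongr
  have h2 := hC x x r hr0 (Metric.ball_subset_ball (by nlinarith [show (0 : ℝ) ≤ d by positivity]))
  have h3 : a * volume (Metric.ball x r) ≤
      weightedMeasure w (Metric.ball x ((d / δ + 1) * r)) := by
    refine (mul_volume_ball_le a (fun x => ?_) x r).trans
      (measure_mono (Metric.ball_subset_ball (by linarith)))
    exact ha.le.trans (iInf_le _ x)
  rw [ENNReal.coe_div (by positivity), ENNReal.div_eq_inv_mul, mul_assoc,
    ENNReal.inv_mul_le_iff (by simp) (by simp)]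
  refine (h3.trans h2).trans ?_
  gcongr
  simp

/-- The `L^1`-norm of `f` on a ball of radius at least `δ` is controlled by its `L^p(μ)`-norm as it
is for Lebesgue measure. -/
theorem IsMuckenhoupt.exists_setLIntegral_le (hp : 1 ≤ p) (hw : IsMuckenhoupt p w)
    (h : 0 < ⨅ x, weightedMeasure w (cube x 1)) {δ : ℝ} (hδ : 0 < δ) :
    ∃ C : ℝ≥0, ∀ (x : EuclideanSpace ℝ (Fin d)) (r : ℝ), δ ≤ r →
      ∀ f : EuclideanSpace ℝ (Fin d) → ℝ≥0∞, AEMeasurable f volume →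
      ∫⁻ z in Metric.ball x r, f z ≤ C * ENNReal.ofReal (r ^ (d - d / p)) *
          (∫⁻ z in Metric.ball x r, f z ^ p ∂(weightedMeasure w)) ^ (1 / p) := by
  obtain ⟨C, hC⟩ := hw.exists_lintegral_rpow_mul_le hp
  obtain ⟨a, ha0, ha⟩ := hw.exists_le_measure_ball hp h hδ
  have hp0 : 0 < p := by linarith
  have hB0 : volume (Metric.ball (0 : EuclideanSpace ℝ (Fin d)) 1) ≠ 0 :=
    (Metric.measure_ball_pos volume _ one_pos).ne'
  have hB : volume (Metric.ball (0 : EuclideanSpace ℝ (Fin d)) 1) ≠ ⊤ := measure_ball_lt_top.ne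
  set β := (volume (Metric.ball (0 : EuclideanSpace ℝ (Fin d)) 1)).toNNReal with hβdef
  have hβ : volume (Metric.ball (0 : EuclideanSpace ℝ (Fin d)) 1) = β :=
    (ENNReal.coe_toNNReal hB).symm
  have hβ0 : β ≠ 0 := fun h => hB0 (by rw [hβ, h]; rfl)
  refine ⟨(C / a) ^ (1 / p) * β ^ ((p - 1) / p), fun x r hr f hf => ?_⟩
  have hr0 : 0 < r := hδ.trans_le hr
  have hV0 : volume (Metric.ball x r) ≠ 0 := (Metric.measure_ball_pos volume x hr0).ne'
  have hV : volume (Metric.ball x r) ≠ ⊤ := measure_ball_lt_top.ne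
  set V := volume (Metric.ball x r) with hVdef
  set N := ∫⁻ z in Metric.ball x r, f z ^ p ∂(weightedMeasure w)
  have hVe : V = ENNReal.ofReal (r ^ d) * β := by
    rw [hVdef, ← hβ, Measure.addHaar_ball_of_pos _ _ hr0]
    simp
  have ha0' : (a : ℝ≥0∞) ≠ 0 := by simpa using ha0.ne'
  have h1 : (∫⁻ z in Metric.ball x r, f z) ^ p ≤ (C / a : ℝ≥0) * V ^ (p - 1) * N := by
    have h2 := (mul_le_mul_right (ha x r hr) ((∫⁻ z in Metric.ball x r, f z) ^ p)).trans
      (hC x r hr0 f hf)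
    have h3 : V ^ p = V * V ^ (p - 1) := by
      nth_rewrite 2 [← ENNReal.rpow_one V]
      rw [← ENNReal.rpow_add _ _ hV0 hV]
      congr 1
      ring
    have h4 : a * V ≠ 0 := mul_ne_zero ha0' hV0
    have h5 : a * V ≠ ⊤ := ENNReal.mul_ne_top ENNReal.coe_ne_top hV
    rw [← ENNReal.mul_le_mul_iff_left h4 h5]
    refine h2.trans_eq ?_
    rw [h3, ENNReal.coe_div ha0.ne']
    calc _ = C * V * V ^ (p - 1) * N * (a / a) := by
          rw [ENNReal.div_self ha0' ENNReal.coe_ne_top]; ring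
      _ = _ := by simp only [div_eq_mul_inv]; ring
  have h6 : ∫⁻ z in Metric.ball x r, f z ≤ ((C / a : ℝ≥0) * V ^ (p - 1) * N) ^ (1 / p) := by
    rw [one_div, ENNReal.le_rpow_inv_iff hp0]
    exact h1
  refine h6.trans_eq ?_
  have hp1 : (0 : ℝ) ≤ 1 / p := by positivity
  rw [ENNReal.mul_rpow_of_nonneg _ _ hp1, ENNReal.mul_rpow_of_nonneg _ _ hp1, hVe,
    ENNReal.mul_rpow_of_nonneg _ _ (by linarith : 0 ≤ p - 1), ENNReal.mul_rpow_of_nonneg _ _ hp1,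
    ENNReal.ofReal_rpow_of_pos (by positivity), ENNReal.ofReal_rpow_of_pos (by positivity),
    ← ENNReal.rpow_mul]
  have e1 : ((r ^ d) ^ (p - 1)) ^ (1 / p) = r ^ (d - d / p) := by
    rw [← Real.rpow_natCast, ← Real.rpow_mul hr0.le, ← Real.rpow_mul hr0.le]
    congr 1
    field_simp
  rw [e1, ENNReal.coe_mul, ENNReal.coe_rpow_of_nonneg _ hp1,
    ENNReal.coe_rpow_of_ne_zero hβ0, mul_one_div]
  ring

end

/-! ### Mollification of weakly differentiable functions -/

section

section Mollification

variable {d : ℕ} {F : Type*} [NormedAddCommGroup F] [NormedSpace ℝ F]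

theorem exists_setLIntegral_enorm_translate_sub_le {f : EuclideanSpace ℝ (Fin d) → F}
    (hf : LocallyIntegrable f volume) (R : ℝ) {ε : ℝ≥0∞} (hε : ε ≠ 0) :
    ∃ δ > 0, ∀ t : EuclideanSpace ℝ (Fin d), ‖t‖ < δ →
      ∫⁻ x in Metric.ball 0 R, ‖f (x - t) - f x‖ₑ ≤ ε := by
  have hε3 : ε / 3 ≠ 0 := by simp [hε]
  set f' := (Metric.closedBall 0 (R + 1)).indicator f with hf'
  have hint : Integrable f' volume :=
    (hf.integrableOn_isCompact (isCompact_closedBall _ _)).integrable_indicator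
      measurableSet_closedBall
  obtain ⟨h, hc, hle, hcont, hhint⟩ := hint.exists_hasCompactSupport_lintegral_sub_le hε3
  have hV : volume (Metric.ball (0 : EuclideanSpace ℝ (Fin d)) R) ≠ ⊤ := measure_ball_lt_top.ne
  obtain ⟨η, hη0, hη⟩ : ∃ η : ℝ≥0, 0 < η ∧
      η * volume (Metric.ball (0 : EuclideanSpace ℝ (Fin d)) R) < ε / 3 :=
    ENNReal.exists_nnreal_pos_mul_lt hV hε3
  obtain ⟨δ, hδ0, hδ⟩ := Metric.uniformContinuous_iff.1
    (hc.uniformContinuous_of_continuous hcont) η hη0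
  refine ⟨min δ 1, by positivity, fun t ht => ?_⟩
  have h1 : ∫⁻ x in Metric.ball 0 R, ‖f (x - t) - f x‖ₑ ≤ ∫⁻ x in Metric.ball 0 R,
      (‖f' (x - t) - h (x - t)‖ₑ + (η + ‖f' x - h x‖ₑ)) := by
    refine setLIntegral_mono' measurableSet_ball fun x hx => ?_
    have hx' : ‖x‖ < R := by simpa using hx
    have ht1 : ‖t‖ < 1 := ht.trans_le (min_le_right _ _)
    have e1 : f x = f' x := by
      rw [hf', indicator_of_mem]
      rw [mem_closedBall_zero_iff]
      linarith
    have e2 : f (x - t) = f' (x - t) := by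
      rw [hf', indicator_of_mem]
      rw [mem_closedBall_zero_iff]
      linarith [norm_sub_le x t]
    have e3 : ‖h (x - t) - h x‖ₑ ≤ η := by
      have : dist (h (x - t)) (h x) < η := hδ (by
        rw [dist_eq_norm]; simpa using ht.trans_le (min_le_left _ _))
      rw [← edist_eq_enorm_sub, edist_nndist]
      exact_mod_cast this.le
    rw [e1, e2]
    calc ‖f' (x - t) - f' x‖ₑ
        = ‖(f' (x - t) - h (x - t)) + ((h (x - t) - h x) - (f' x - h x))‖ₑ := by
          congr 1; abel
      _ ≤ _ := by
          refine (enorm_add_le _ _).trans ?_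
          gcongr
          refine enorm_sub_le.trans ?_
          gcongr
  have hm : AEMeasurable (fun x => ‖f' x - h x‖ₑ) (volume.restrict (Metric.ball 0 R)) :=
    (hint.aestronglyMeasurable.sub hcont.aestronglyMeasurable).enorm.restrict
  refine h1.trans ?_
  rw [lintegral_add_right' _ (hm.const_add _), lintegral_add_right' _ hm,
    setLIntegral_const]
  calc _ ≤ ε / 3 + (ε / 3 + ε / 3) := by
        gcongr
        · refine (setLIntegral_le_lintegral _ _).trans ?_
          rw [lintegral_sub_right_eq_self (fun x => ‖f' x - h x‖ₑ) t]
          exact hle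
        · exact (setLIntegral_le_lintegral _ _).trans hle
    _ = ε := by rw [← add_assoc, ENNReal.add_thirds]

/-- Mollifications converge locally in `L^1`. -/
theorem exists_setLIntegral_enorm_convolution_sub_le [CompleteSpace F]
    {f : EuclideanSpace ℝ (Fin d) → F}
    (hf : LocallyIntegrable f volume) (hfm : StronglyMeasurable f) (R : ℝ) {ε : ℝ≥0∞}
    (hε : ε ≠ 0) :
    ∃ δ > 0, ∀ φ : ContDiffBump (0 : EuclideanSpace ℝ (Fin d)), φ.rOut < δ →
      ∫⁻ x in Metric.ball 0 R,
        ‖convolution (φ.normed volume) f (ContinuousLinearMap.lsmul ℝ ℝ) volume x - f x‖ₑ ≤ ε := by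
  obtain ⟨δ, hδ0, hδ⟩ := exists_setLIntegral_enorm_translate_sub_le hf R hε
  refine ⟨δ, hδ0, fun φ hφ => ?_⟩
  set ψ := φ.normed volume with hψ
  have hψc : Continuous ψ := φ.continuous_normed
  have hψi : Integrable ψ volume := φ.integrable_normed
  have hone : ∫⁻ t, ‖ψ t‖ₑ = 1 := by
    have h1 : ∫ t, ψ t = 1 := φ.integral_normed
    have h2 : ∀ t, ‖ψ t‖ₑ = ENNReal.ofReal (ψ t) := fun t =>
      Real.enorm_of_nonneg (φ.nonneg_normed t)
    simp_rw [h2]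
    rw [← ofReal_integral_eq_lintegral_ofReal hψi (Eventually.of_forall φ.nonneg_normed), h1]
    simp
  have hex (x) : Integrable (fun t => ψ t • f (x - t)) volume :=
    φ.hasCompactSupport_normed.convolutionExists_left (ContinuousLinearMap.lsmul ℝ ℝ) hψc hf x
  calc _ ≤ ∫⁻ x in Metric.ball 0 R, ∫⁻ t, ‖ψ t‖ₑ * ‖f (x - t) - f x‖ₑ := by
        refine lintegral_mono fun x => ?_
        have : convolution ψ f (ContinuousLinearMap.lsmul ℝ ℝ) volume x - f x =
            ∫ t, ψ t • (f (x - t) - f x) := by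
          simp_rw [smul_sub]
          rw [integral_sub (hex x) (hψi.smul_const _), integral_smul_const, φ.integral_normed,
            one_smul]
          rfl
        rw [this]
        refine (enorm_integral_le_lintegral_enorm _).trans_eq ?_
        simp_rw [enorm_smul]
    _ = ∫⁻ t, ∫⁻ x in Metric.ball 0 R, ‖ψ t‖ₑ * ‖f (x - t) - f x‖ₑ := by
        refine lintegral_lintegral_swap (StronglyMeasurable.aemeasurable ?_)
        have h1 : StronglyMeasurable fun z : EuclideanSpace ℝ (Fin d) × EuclideanSpace ℝ (Fin d) =>
          f (z.1 - z.2) := hfm.comp_measurable (by fun_prop)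
        have h2 : StronglyMeasurable fun z : EuclideanSpace ℝ (Fin d) × EuclideanSpace ℝ (Fin d) =>
          f z.1 := hfm.comp_measurable (by fun_prop)
        have h3 : Measurable fun z : EuclideanSpace ℝ (Fin d) × EuclideanSpace ℝ (Fin d) =>
          ‖ψ z.2‖ₑ := (hψc.comp continuous_snd).enorm.measurable
        exact (h3.mul (h1.sub h2).enorm).stronglyMeasurable
    _ = ∫⁻ t, ‖ψ t‖ₑ * ∫⁻ x in Metric.ball 0 R, ‖f (x - t) - f x‖ₑ := by
        refine lintegral_congr fun t => ?_
        rw [lintegral_const_mul' _ _ enorm_ne_top]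
    _ ≤ ∫⁻ t, ‖ψ t‖ₑ * ε := by
        refine lintegral_mono fun t => ?_
        by_cases ht : ‖t‖ < φ.rOut
        · exact mul_le_mul_right (hδ t (ht.trans hφ)) _
        · have : ψ t = 0 := by
            have : t ∉ Function.support ψ := by
              rw [hψ, φ.support_normed_eq]; simpa using ht
            simpa using this
          simp [this]
    _ = ε := by
        rw [lintegral_mul_const _ hψc.enorm.measurable, hone, one_mul]

end Mollification

variable {d : ℕ} {u : EuclideanSpace ℝ (Fin d) → ℝ}
  {g : EuclideanSpace ℝ (Fin d) → EuclideanSpace ℝ (Fin d)}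

/-- The gradient of a mollification is the mollification of the weak gradient. -/
theorem HasWeakGradient.hasFDerivAt_convolution (h : HasWeakGradient u g)
    {φ : EuclideanSpace ℝ (Fin d) → ℝ} (hφ : ContDiff ℝ ∞ φ) (hc : HasCompactSupport φ)
    (x : EuclideanSpace ℝ (Fin d)) :
    HasFDerivAt (convolution φ u (ContinuousLinearMap.lsmul ℝ ℝ) volume)
      (innerSL ℝ (convolution φ g (ContinuousLinearMap.lsmul ℝ ℝ) volume x)) x := by
  have hφ1 : ContDiff ℝ 1 φ := hφ.of_le (by exact_mod_cast le_top)
  have h1 := hc.hasFDerivAt_convolution_left (ContinuousLinearMap.lsmul ℝ ℝ) hφ1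
    h.locallyIntegrable x
  refine h1.congr_fderiv ?_
  have hex := (hc.fderiv (𝕜 := ℝ)).convolutionExists_left
    ((ContinuousLinearMap.lsmul ℝ ℝ : ℝ →L[ℝ] ℝ →L[ℝ] ℝ).precompL (EuclideanSpace ℝ (Fin d)))
    (hφ1.continuous_fderiv one_ne_zero) h.locallyIntegrable x
  have hex2 : Integrable (fun t => φ t • g (x - t)) volume :=
    hc.convolutionExists_left (ContinuousLinearMap.lsmul ℝ ℝ) hφ.continuous
      h.locallyIntegrable_grad x
  apply ContinuousLinearMap.coe_injective
  refine (EuclideanSpace.basisFun (Fin d) ℝ).toBasis.ext fun i => ?_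
  have e1 : (convolution (fderiv ℝ φ) u ((ContinuousLinearMap.lsmul ℝ ℝ : ℝ →L[ℝ] ℝ →L[ℝ]
      ℝ).precompL (EuclideanSpace ℝ (Fin d))) volume x) (EuclideanSpace.single i 1) =
      ∫ t, u t * fderiv ℝ φ (x - t) (EuclideanSpace.single i 1) := by
    rw [convolution_def, ContinuousLinearMap.integral_apply hex,
      ← integral_sub_left_eq_self _ _ x]
    refine integral_congr_ae (Eventually.of_forall fun t => ?_)
    simp [ContinuousLinearMap.precompL_apply, mul_comm]
  have e2 : (convolution φ g (ContinuousLinearMap.lsmul ℝ ℝ) volume x) i =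
      ∫ t, g t i * φ (x - t) := by
    have := (EuclideanSpace.proj i : EuclideanSpace ℝ (Fin d) →L[ℝ] ℝ).integral_comp_comm hex2
    rw [convolution_def]
    refine Eq.trans this.symm ?_
    rw [← integral_sub_left_eq_self _ _ x]
    refine integral_congr_ae (Eventually.of_forall fun t => ?_)
    simp [mul_comm]
  have hψ : ContDiff ℝ ∞ (fun t => φ (x - t)) := hφ.comp (contDiff_const.sub contDiff_id)
  have hψc : HasCompactSupport (fun t => φ (x - t)) := hc.comp_homeomorph (Homeomorph.subLeft x)
  have e3 := h.integral_eq _ hψ hψc i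
  have e4 : ∀ t, fderiv ℝ (fun t => φ (x - t)) t = - fderiv ℝ φ (x - t) := by
    intro t
    have h2 := ((hφ1.differentiable one_ne_zero).differentiableAt.hasFDerivAt).comp t
      ((hasFDerivAt_id t).const_sub x)
    refine h2.fderiv.trans ?_
    ext; simp
  simp_rw [e4] at e3
  simp only [neg_apply, mul_neg, integral_neg, neg_inj] at e3
  simp only [OrthonormalBasis.coe_toBasis, EuclideanSpace.basisFun_apply,
    ContinuousLinearMap.coe_coe]
  rw [e1, e3, ← e2]
  simp [EuclideanSpace.inner_single_right]

/-! ### Increments under dilations -/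

theorem lintegral_comp_dilation (f : EuclideanSpace ℝ (Fin d) → ℝ≥0∞)
    (z : EuclideanSpace ℝ (Fin d)) {s : ℝ} (hs : 0 < s) :
    ∫⁻ y, f (z + s • (y - z)) = ENNReal.ofReal ((s ^ d)⁻¹) * ∫⁻ y, f y := by
  have h1 : ∫⁻ y, f (z + s • (y - z)) = ∫⁻ y, f (z + s • y) :=
    lintegral_sub_right_eq_self (fun y => f (z + s • y)) z
  have h2 := lintegral_map_equiv (μ := volume) (fun y => f (z + y))
    (Homeomorph.smulOfNeZero s hs.ne').toMeasurableEquiv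
  have h3 : Measure.map (Homeomorph.smulOfNeZero s hs.ne').toMeasurableEquiv
      (volume : Measure (EuclideanSpace ℝ (Fin d))) =
      ENNReal.ofReal |(s ^ Module.finrank ℝ (EuclideanSpace ℝ (Fin d)))⁻¹| • volume :=
    Measure.map_addHaar_smul volume hs.ne'
  rw [h3, lintegral_smul_measure, lintegral_add_left_eq_self] at h2
  rw [h1]
  refine Eq.trans h2.symm ?_
  rw [abs_of_pos (by positivity)]
  simp

theorem setLIntegral_comp_dilation_le (f : EuclideanSpace ℝ (Fin d) → ℝ≥0∞)
    (z : EuclideanSpace ℝ (Fin d)) {s : ℝ} (hs : 1 ≤ s) {A B : Set (EuclideanSpace ℝ (Fin d))}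
    (hA : MeasurableSet A) (hB : MeasurableSet B) (hAB : ∀ y ∈ A, z + s • (y - z) ∈ B) :
    ∫⁻ y in A, f (z + s • (y - z)) ≤ ∫⁻ y in B, f y := by
  have hs0 : 0 < s := by linarith
  calc ∫⁻ y in A, f (z + s • (y - z)) ≤ ∫⁻ y in A, B.indicator f (z + s • (y - z)) := by
        refine setLIntegral_mono' hA fun y hy => ?_
        rw [indicator_of_mem (hAB y hy)]
    _ ≤ ∫⁻ y, B.indicator f (z + s • (y - z)) := setLIntegral_le_lintegral _ _
    _ = ENNReal.ofReal ((s ^ d)⁻¹) * ∫⁻ y in B, f y := by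
        rw [lintegral_comp_dilation _ _ hs0, lintegral_indicator hB]
    _ ≤ 1 * ∫⁻ y in B, f y := by
        gcongr
        rw [ENNReal.ofReal_le_one]
        exact inv_le_one_of_one_le₀ (one_le_pow₀ hs)
    _ = _ := one_mul _

theorem enorm_dilation_sub_le_of_hasFDerivAt {v : EuclideanSpace ℝ (Fin d) → ℝ}
    {γ : EuclideanSpace ℝ (Fin d) → EuclideanSpace ℝ (Fin d)}
    (hv : ∀ x, HasFDerivAt v (innerSL ℝ (γ x)) x) (hγ : Continuous γ)
    (z y : EuclideanSpace ℝ (Fin d)) {lam : ℝ} (hlam : 1 ≤ lam) :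
    ‖v (z + lam • (y - z)) - v y‖ₑ ≤
      ∫⁻ s in Ioc 1 lam, ‖γ (z + s • (y - z))‖ₑ * ‖y - z‖ₑ := by
  have hderiv : ∀ s ∈ uIcc 1 lam, HasDerivAt (fun s : ℝ => v (z + s • (y - z)))
      (inner ℝ (γ (z + s • (y - z))) (y - z)) s := by
    intro s _
    have h1 : HasDerivAt (fun s : ℝ => z + s • (y - z)) (y - z) s := by
      simpa using ((hasDerivAt_id s).smul_const (y - z)).const_add z
    exact (hv (z + s • (y - z))).comp_hasDerivAt s h1
  have hcont : Continuous fun s : ℝ => (inner ℝ (γ (z + s • (y - z))) (y - z) : ℝ) := by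
    fun_prop
  have h := intervalIntegral.integral_eq_sub_of_hasDerivAt hderiv (hcont.intervalIntegrable _ _)
  simp only [one_smul, add_sub_cancel] at h
  rw [← h, intervalIntegral.integral_of_le hlam]
  refine (enorm_integral_le_lintegral_enorm _).trans (lintegral_mono fun s => ?_)
  rw [← ofReal_norm, ← ofReal_norm, ← ofReal_norm, ← ENNReal.ofReal_mul (norm_nonneg _)]
  exact ENNReal.ofReal_le_ofReal (norm_inner_le_norm _ _)

/-- Perturbation of the gradient in the fundamental theorem of calculus: the gradient `γ` of `v` is
replaced by `g`, at the cost of the `L^1`-distance of `γ` and `g` on a large ball. -/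
theorem setLIntegral_enorm_dilation_sub_le_add {v : EuclideanSpace ℝ (Fin d) → ℝ}
    {γ : EuclideanSpace ℝ (Fin d) → EuclideanSpace ℝ (Fin d)}
    (hv : ∀ x, HasFDerivAt v (innerSL ℝ (γ x)) x) (hγ : Continuous γ) (hg : Measurable g)
    {z x : EuclideanSpace ℝ (Fin d)} {r lam M R : ℝ} (hlam : 1 ≤ lam)
    (hyM : ∀ y ∈ Metric.ball x r, ‖y - z‖ < M)
    (hyR : ∀ y ∈ Metric.ball x r, ∀ s : ℝ, 1 ≤ s → s ≤ lam →
      z + s • (y - z) ∈ Metric.ball 0 R) :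
    ∫⁻ y in Metric.ball x r, ‖v (z + lam • (y - z)) - v y‖ₑ ≤
      (∫⁻ y in Metric.ball x r, ∫⁻ s in Ioc 1 lam, ‖g (z + s • (y - z))‖ₑ * ‖y - z‖ₑ) +
        ENNReal.ofReal M * ENNReal.ofReal (lam - 1) * ∫⁻ y in Metric.ball 0 R, ‖γ y - g y‖ₑ := by
  have hmeas : Measurable fun q : EuclideanSpace ℝ (Fin d) × ℝ =>
      ‖γ (z + q.2 • (q.1 - z)) - g (z + q.2 • (q.1 - z))‖ₑ := by
    have h1 : Measurable fun q : EuclideanSpace ℝ (Fin d) × ℝ => z + q.2 • (q.1 - z) := by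
      fun_prop
    exact ((hγ.measurable.comp h1).sub (hg.comp h1)).enorm
  have hab (a b : EuclideanSpace ℝ (Fin d)) (e M' : ℝ≥0∞) (h : e ≤ M') :
      ‖a‖ₑ * e ≤ ‖b‖ₑ * e + ‖a - b‖ₑ * M' := by
    calc ‖a‖ₑ * e = ‖b + (a - b)‖ₑ * e := by rw [add_sub_cancel]
      _ ≤ (‖b‖ₑ + ‖a - b‖ₑ) * e := by gcongr; exact enorm_add_le _ _
      _ ≤ _ := by rw [add_mul]; gcongr
  have hmeas2 : Measurable fun q : EuclideanSpace ℝ (Fin d) × ℝ =>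
      ‖g (z + q.2 • (q.1 - z))‖ₑ * ‖q.1 - z‖ₑ := by
    have h1 : Measurable fun q : EuclideanSpace ℝ (Fin d) × ℝ => z + q.2 • (q.1 - z) := by
      fun_prop
    exact (hg.comp h1).enorm.mul (by fun_prop)
  have hA : Measurable fun y : EuclideanSpace ℝ (Fin d) =>
      ∫⁻ s in Ioc 1 lam, ‖g (z + s • (y - z))‖ₑ * ‖y - z‖ₑ := hmeas2.lintegral_prod_right'
  calc _ ≤ ∫⁻ y in Metric.ball x r, ((∫⁻ s in Ioc 1 lam, ‖g (z + s • (y - z))‖ₑ * ‖y - z‖ₑ) +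
        ∫⁻ s in Ioc 1 lam,
          ‖γ (z + s • (y - z)) - g (z + s • (y - z))‖ₑ * ENNReal.ofReal M) := by
        refine setLIntegral_mono' measurableSet_ball fun y hy => ?_
        refine (enorm_dilation_sub_le_of_hasFDerivAt hv hγ z y hlam).trans ?_
        have hm : Measurable fun s : ℝ => ‖g (z + s • (y - z))‖ₑ * ‖y - z‖ₑ :=
          (hg.comp (by fun_prop : Measurable fun s : ℝ => z + s • (y - z))).enorm.mul_const _
        rw [← lintegral_add_left hm]
        have h2 : ‖y - z‖ₑ ≤ ENNReal.ofReal M := by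
          rw [← ofReal_norm]
          exact ENNReal.ofReal_le_ofReal (hyM y hy).le
        exact lintegral_mono fun s => hab _ _ _ _ h2
    _ = (∫⁻ y in Metric.ball x r, ∫⁻ s in Ioc 1 lam, ‖g (z + s • (y - z))‖ₑ * ‖y - z‖ₑ) +
        ∫⁻ y in Metric.ball x r, ∫⁻ s in Ioc 1 lam,
          ‖γ (z + s • (y - z)) - g (z + s • (y - z))‖ₑ * ENNReal.ofReal M := by
        rw [lintegral_add_left hA]
    _ ≤ _ := by
        refine add_le_add_right ?_ _
        have hsw := lintegral_lintegral_swap (μ := volume.restrict (Metric.ball x r))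
          (ν := volume.restrict (Ioc 1 lam)) (f := fun y s =>
            ‖γ (z + s • (y - z)) - g (z + s • (y - z))‖ₑ * ENNReal.ofReal M)
          (hmeas.mul_const (ENNReal.ofReal M)).aemeasurable
        rw [hsw]
        calc _ ≤ ∫⁻ s in Ioc 1 lam, (∫⁻ y in Metric.ball 0 R, ‖γ y - g y‖ₑ) * ENNReal.ofReal M := by
              refine setLIntegral_mono' measurableSet_Ioc fun s hs => ?_
              rw [lintegral_mul_const' _ _ ENNReal.ofReal_ne_top]
              refine mul_le_mul_left ?_ _
              exact setLIntegral_comp_dilation_le (fun y => ‖γ y - g y‖ₑ) z hs.1.le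
                measurableSet_ball measurableSet_ball fun y hy => hyR y hy s hs.1.le hs.2
          _ = _ := by
              rw [setLIntegral_const, Real.volume_Ioc]
              ring

/-- The fundamental theorem of calculus along the rays from `z`, integrated over a ball. -/
theorem HasWeakGradient.setLIntegral_enorm_dilation_sub_le (h : HasWeakGradient u g)
    (hu : Measurable u) (hg : Measurable g) (z x : EuclideanSpace ℝ (Fin d)) (r : ℝ) {lam : ℝ}
    (hlam : 1 ≤ lam) :
    ∫⁻ y in Metric.ball x r, ‖u (z + lam • (y - z)) - u y‖ₑ ≤
      ∫⁻ y in Metric.ball x r, ∫⁻ s in Ioc 1 lam, ‖g (z + s • (y - z))‖ₑ * ‖y - z‖ₑ := by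
  -- all points involved lie in the ball of radius `R` about the origin
  set M := r + ‖x - z‖ with hM
  set R := ‖z‖ + lam * M with hR
  have hyM : ∀ y ∈ Metric.ball x r, ‖y - z‖ < M := by
    intro y hy
    rw [Metric.mem_ball, dist_eq_norm] at hy
    calc ‖y - z‖ = ‖(y - x) + (x - z)‖ := by congr 1; abel
      _ ≤ ‖y - x‖ + ‖x - z‖ := norm_add_le _ _
      _ < M := by linarith
  have hyR : ∀ y ∈ Metric.ball x r, ∀ s : ℝ, 1 ≤ s → s ≤ lam →
      z + s • (y - z) ∈ Metric.ball 0 R := by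
    intro y hy s hs1 hs2
    rw [mem_ball_zero_iff]
    have h1 := hyM y hy
    calc ‖z + s • (y - z)‖ ≤ ‖z‖ + ‖s • (y - z)‖ := norm_add_le _ _
      _ = ‖z‖ + s * ‖y - z‖ := by rw [norm_smul, Real.norm_of_nonneg (by linarith)]
      _ < ‖z‖ + s * M := by gcongr
      _ ≤ R := by
        rw [hR]
        have : 0 ≤ M := (norm_nonneg _).trans h1.le
        gcongr
  have hyR1 : Metric.ball x r ⊆ Metric.ball 0 R := fun y hy => by
    simpa using hyR y hy 1 le_rfl hlam
  -- `K` collects the distances to the mollifications: twice that of `u`, and that of the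
  -- gradient once, with a factor
  refine ENNReal.le_of_forall_pos_le_add fun ε hε _ => ?_
  set K : ℝ≥0∞ := 2 + ENNReal.ofReal M * ENNReal.ofReal (lam - 1) with hK
  have hKtop : K ≠ ⊤ := by simp [hK, ENNReal.mul_eq_top]
  have hK0 : K ≠ 0 := by simp [hK]
  have hε' : (ε : ℝ≥0∞) / K ≠ 0 := by
    simp [hKtop, hε.ne']
  set ε' := (ε : ℝ≥0∞) / K
  obtain ⟨δ₁, hδ₁, h₁⟩ := exists_setLIntegral_enorm_convolution_sub_le h.locallyIntegrable
    hu.stronglyMeasurable R hε'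
  obtain ⟨δ₂, hδ₂, h₂⟩ := exists_setLIntegral_enorm_convolution_sub_le h.locallyIntegrable_grad
    hg.stronglyMeasurable R hε'
  have hδ : 0 < min δ₁ δ₂ := lt_min hδ₁ hδ₂
  set φ : ContDiffBump (0 : EuclideanSpace ℝ (Fin d)) :=
    ⟨min δ₁ δ₂ / 4, min δ₁ δ₂ / 2, by positivity, by linarith⟩ with hφ
  have hφ1 : φ.rOut = min δ₁ δ₂ / 2 := rfl
  replace h₁ := h₁ φ (by linarith [min_le_left δ₁ δ₂])
  replace h₂ := h₂ φ (by linarith [min_le_right δ₁ δ₂])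
  set v := convolution (φ.normed volume) u (ContinuousLinearMap.lsmul ℝ ℝ) volume
  set γ := convolution (φ.normed volume) g (ContinuousLinearMap.lsmul ℝ ℝ) volume
  have hv : ∀ x, HasFDerivAt v (innerSL ℝ (γ x)) x :=
    h.hasFDerivAt_convolution φ.contDiff_normed φ.hasCompactSupport_normed
  have hγ : Continuous γ :=
    φ.hasCompactSupport_normed.continuous_convolution_left _ φ.continuous_normed
      h.locallyIntegrable_grad
  have hvc : Continuous v := continuous_iff_continuousAt.2 fun x => (hv x).continuousAt
  have hI : ∫⁻ y in Metric.ball x r, ‖v (z + lam • (y - z)) - v y‖ₑ ≤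
      (∫⁻ y in Metric.ball x r, ∫⁻ s in Ioc 1 lam, ‖g (z + s • (y - z))‖ₑ * ‖y - z‖ₑ) +
        ENNReal.ofReal M * ENNReal.ofReal (lam - 1) * ε' := by
    refine (setLIntegral_enorm_dilation_sub_le_add hv hγ hg hlam hyM hyR).trans ?_
    gcongr
  have hm1 : Measurable fun y => ‖v y - u y‖ₑ := (hvc.measurable.sub hu).enorm
  have hm2 : Measurable fun y => ‖v (z + lam • (y - z)) - v y‖ₑ + ‖v y - u y‖ₑ := by fun_prop
  calc _ ≤ ∫⁻ y in Metric.ball x r, (‖v (z + lam • (y - z)) - u (z + lam • (y - z))‖ₑ +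
        (‖v (z + lam • (y - z)) - v y‖ₑ + ‖v y - u y‖ₑ)) := by
        refine lintegral_mono fun y => ?_
        calc ‖u (z + lam • (y - z)) - u y‖ₑ
            = ‖(v (z + lam • (y - z)) - v y + (v y - u y)) -
                (v (z + lam • (y - z)) - u (z + lam • (y - z)))‖ₑ := by congr 1; ring
          _ ≤ _ := by
            refine enorm_sub_le.trans ?_
            rw [add_comm]
            gcongr
            exact enorm_add_le _ _
    _ = (∫⁻ y in Metric.ball x r, ‖v (z + lam • (y - z)) - u (z + lam • (y - z))‖ₑ) +
        ((∫⁻ y in Metric.ball x r, ‖v (z + lam • (y - z)) - v y‖ₑ) +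
          ∫⁻ y in Metric.ball x r, ‖v y - u y‖ₑ) := by
        rw [lintegral_add_right _ hm2, lintegral_add_right _ hm1]
    _ ≤ ε' + (((∫⁻ y in Metric.ball x r, ∫⁻ s in Ioc 1 lam,
          ‖g (z + s • (y - z))‖ₑ * ‖y - z‖ₑ) +
        ENNReal.ofReal M * ENNReal.ofReal (lam - 1) * ε') + ε') := by
        gcongr
        · refine (setLIntegral_comp_dilation_le (fun y => ‖v y - u y‖ₑ) z hlam
            measurableSet_ball measurableSet_ball fun y hy => ?_).trans h₁
          exact hyR y hy lam hlam le_rfl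
        · exact (lintegral_mono_set hyR1).trans h₁
    _ = (∫⁻ y in Metric.ball x r, ∫⁻ s in Ioc 1 lam, ‖g (z + s • (y - z))‖ₑ * ‖y - z‖ₑ) +
        K * ε' := by
        rw [hK]; ring
    _ = _ := by rw [ENNReal.mul_div_cancel hK0 hKtop]

end

/-! ### Averages over balls -/

section

variable {d : ℕ} {p : ℝ} {w u : EuclideanSpace ℝ (Fin d) → ℝ}
  {G : EuclideanSpace ℝ (Fin d) → ℝ≥0∞}

/-- The average of `u` over the ball `B(x, r)`, for Lebesgue measure. -/
noncomputable def ballAverage (u : EuclideanSpace ℝ (Fin d) → ℝ) (x : EuclideanSpace ℝ (Fin d))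
    (r : ℝ) : ℝ :=
  ⨍ y in Metric.ball x r, u y ∂volume

/-- `G` controls the change of the averages of `u` when a ball is dilated about a point `z`, as the
length of the weak gradient does. -/
structure DilationBound (u : EuclideanSpace ℝ (Fin d) → ℝ)
    (G : EuclideanSpace ℝ (Fin d) → ℝ≥0∞) : Prop where
  measurable : Measurable G
  bound : ∀ (z x : EuclideanSpace ℝ (Fin d)) (r lam : ℝ), 0 < r → 1 ≤ lam →
    ‖ballAverage u x r - ballAverage u (z + lam • (x - z)) (lam * r)‖ₑ *
        volume (Metric.ball x r) ≤
      ∫⁻ y in Metric.ball x r, ∫⁻ s in Ioc 1 lam, G (z + s • (y - z)) * ‖y - z‖ₑ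

theorem ball_ae_eq_closedBall (x : EuclideanSpace ℝ (Fin d)) {r : ℝ} (hr : r ≠ 0) :
    (Metric.ball x r : Set _) =ᵐ[volume] Metric.closedBall x r := by
  rw [← Metric.ball_union_sphere]
  exact (union_ae_eq_left_of_ae_eq_empty
    (ae_eq_empty.2 (Measure.addHaar_sphere_of_ne_zero volume x hr))).symm

theorem volume_ball_mul (x y : EuclideanSpace ℝ (Fin d)) {s : ℝ} (hs : 0 < s) (r : ℝ) :
    volume (Metric.ball x (s * r)) = ENNReal.ofReal (s ^ d) * volume (Metric.ball y r) := by
  rw [Measure.addHaar_ball_mul_of_pos _ _ hs, Measure.addHaar_ball_center volume y r]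
  simp

theorem dilation_mem_ball_iff {z x y : EuclideanSpace ℝ (Fin d)} {r lam : ℝ} (hlam : 0 < lam) :
    z + lam • (y - z) ∈ Metric.ball (z + lam • (x - z)) (lam * r) ↔ y ∈ Metric.ball x r := by
  rw [Metric.mem_ball, Metric.mem_ball, dist_add_left, dist_smul₀, dist_sub_right,
    Real.norm_of_nonneg hlam.le]
  exact mul_lt_mul_iff_right₀ hlam

theorem ballAverage_dilation (u : EuclideanSpace ℝ (Fin d) → ℝ) (z x : EuclideanSpace ℝ (Fin d))
    (r : ℝ) {lam : ℝ} (hlam : 0 < lam) :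
    ballAverage u (z + lam • (x - z)) (lam * r) =
      ⨍ y in Metric.ball x r, u (z + lam • (y - z)) := by
  have h1 : ∫ y in Metric.ball x r, u (z + lam • (y - z)) =
      (lam ^ d)⁻¹ * ∫ y in Metric.ball (z + lam • (x - z)) (lam * r), u y := by
    rw [← integral_indicator measurableSet_ball, ← integral_indicator measurableSet_ball]
    have h2 := integral_sub_right_eq_self (μ := (volume : Measure (EuclideanSpace ℝ (Fin d))))
      (fun y => (Metric.ball (z + lam • (x - z)) (lam * r)).indicator u (z + lam • y)) z
    have h3 := Measure.integral_comp_smul (volume : Measure (EuclideanSpace ℝ (Fin d)))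
      (fun y => (Metric.ball (z + lam • (x - z)) (lam * r)).indicator u (z + y)) lam
    have h4 := integral_add_left_eq_self (μ := (volume : Measure (EuclideanSpace ℝ (Fin d))))
      (fun y => (Metric.ball (z + lam • (x - z)) (lam * r)).indicator u y) z
    rw [h4, abs_of_pos (by positivity), finrank_euclideanSpace_fin] at h3
    rw [h3] at h2
    refine Eq.trans (integral_congr_ae (Eventually.of_forall fun y => ?_)) h2
    by_cases hy : y ∈ Metric.ball x r
    · simp only [indicator_of_mem hy, indicator_of_mem ((dilation_mem_ball_iff hlam).2 hy)]
    · simp only [indicator_of_notMem hy,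
        indicator_of_notMem (mt (dilation_mem_ball_iff hlam).1 hy)]
  rw [ballAverage, setAverage_eq, setAverage_eq, h1, measureReal_def, measureReal_def,
    volume_ball_mul _ x hlam, ENNReal.toReal_mul, ENNReal.toReal_ofReal (by positivity)]
  simp only [smul_eq_mul, mul_inv]
  ring

theorem HasWeakGradient.congr {u' : EuclideanSpace ℝ (Fin d) → ℝ}
    {g g' : EuclideanSpace ℝ (Fin d) → EuclideanSpace ℝ (Fin d)} (h : HasWeakGradient u g)
    (hu : u =ᵐ[volume] u') (hg : g =ᵐ[volume] g') : HasWeakGradient u' g' where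
  locallyIntegrable := h.locallyIntegrable.congr hu
  locallyIntegrable_grad := h.locallyIntegrable_grad.congr hg
  integral_eq φ hφ hc i := by
    have h1 : ∫ x, u' x * fderiv ℝ φ x (EuclideanSpace.single i 1) =
        ∫ x, u x * fderiv ℝ φ x (EuclideanSpace.single i 1) :=
      integral_congr_ae (by filter_upwards [hu] with x hx; rw [hx])
    have h2 : ∫ x, g' x i * φ x = ∫ x, g x i * φ x :=
      integral_congr_ae (by filter_upwards [hg] with x hx; rw [hx])
    rw [h1, h2, h.integral_eq φ hφ hc i]

theorem HasWeakGradient.dilationBound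
    {g : EuclideanSpace ℝ (Fin d) → EuclideanSpace ℝ (Fin d)} (h : HasWeakGradient u g)
    (hg : Measurable g) : DilationBound u fun x => ‖g x‖ₑ where
  measurable := hg.enorm
  bound z x r lam hr hlam := by
    -- averages do not see the change to a Borel measurable representative
    have hm := h.locallyIntegrable.aestronglyMeasurable
    set u' := hm.mk u with hu'
    have huu' : u =ᵐ[volume] u' := hm.ae_eq_mk
    have hu'm : Measurable u' := hm.stronglyMeasurable_mk.measurable
    have h' : HasWeakGradient u' g := h.congr huu' EventuallyEq.rfl
    have hA : ∀ x r, ballAverage u x r = ballAverage u' x r := fun x r => by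
      rw [ballAverage, ballAverage, setAverage_eq, setAverage_eq,
        integral_congr_ae (ae_restrict_of_ae huu')]
    have hV0 : volume (Metric.ball x r) ≠ 0 := (Metric.measure_ball_pos volume x hr).ne'
    have hV : volume (Metric.ball x r) ≠ ⊤ := measure_ball_lt_top.ne
    have hloc (y : EuclideanSpace ℝ (Fin d)) (ρ : ℝ) : IntegrableOn u' (Metric.ball y ρ) volume :=
      (h'.locallyIntegrable.integrableOn_isCompact (isCompact_closedBall y ρ)).mono_set
        Metric.ball_subset_closedBall
    have hint : IntegrableOn (fun y => u' (z + lam • (y - z))) (Metric.ball x r) volume := by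
      refine ⟨(hu'm.comp (by fun_prop)).aestronglyMeasurable, ?_⟩
      refine (setLIntegral_comp_dilation_le (fun y => ‖u' y‖ₑ) z hlam measurableSet_ball
        measurableSet_ball fun y hy => (dilation_mem_ball_iff (by linarith)).2 hy).trans_lt
          (hloc _ _).2
    rw [hA, hA, ballAverage_dilation _ _ _ _ (by linarith), ballAverage, setAverage_eq,
      setAverage_eq, ← smul_sub, ← integral_sub (hloc x r) hint, enorm_smul, measureReal_def,
      Real.enorm_of_nonneg (by positivity), ENNReal.ofReal_inv_of_pos (ENNReal.toReal_pos hV0 hV),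
      ENNReal.ofReal_toReal hV, mul_comm, ← mul_assoc, ENNReal.mul_inv_cancel hV0 hV, one_mul]
    refine (enorm_integral_le_lintegral_enorm _).trans (le_trans (le_of_eq ?_)
      (h'.setLIntegral_enorm_dilation_sub_le hu'm hg z x r hlam))
    exact lintegral_congr fun y => enorm_sub_rev _ _

theorem MemHomSobolev.exists_dilationBound (hp : 1 ≤ p) (hu : MemHomSobolev p w u) :
    ∃ G, DilationBound u G ∧ ∫⁻ x, G x ^ p ∂(weightedMeasure w) < ⊤ := by
  obtain ⟨g, hg, hgL⟩ := hu.exists_grad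
  have hm := hg.locallyIntegrable_grad.aestronglyMeasurable
  refine ⟨_, (hg.congr EventuallyEq.rfl hm.ae_eq_mk).dilationBound
    hm.stronglyMeasurable_mk.measurable, ?_⟩
  have h1 : ENNReal.ofReal p ≠ 0 := by
    rw [Ne, ENNReal.ofReal_eq_zero]; linarith
  have h2 := (eLpNorm_lt_top_iff_lintegral_rpow_enorm_lt_top h1 ENNReal.ofReal_ne_top).1 hgL.2
  rw [ENNReal.toReal_ofReal (by linarith)] at h2
  refine (lintegral_congr_ae ?_).trans_lt h2
  filter_upwards [weightedMeasure_absolutelyContinuous w hm.ae_eq_mk] with x hx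
  rw [← hx]

theorem norm_sub_le_of_mem_ball {x y z : EuclideanSpace ℝ (Fin d)} {r M : ℝ}
    (hy : y ∈ Metric.ball x r) (h : ‖x - z‖ ≤ M) : ‖y - z‖ ≤ r + M := by
  rw [Metric.mem_ball, dist_eq_norm] at hy
  calc ‖y - z‖ = ‖(y - x) + (x - z)‖ := by congr 1; abel
    _ ≤ ‖y - x‖ + ‖x - z‖ := norm_add_le _ _
    _ ≤ _ := by linarith

/-- Comparison of the averages over two nested balls: a suitable dilation maps one to the other. -/
theorem DilationBound.enorm_sub_mul_le (h : DilationBound u G)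
    {x x' : EuclideanSpace ℝ (Fin d)} {r r' : ℝ} (hr : 0 < r) (hrr' : r < r')
    (hx : dist x x' ≤ r' - r) :
    ‖ballAverage u x r - ballAverage u x' r'‖ₑ * volume (Metric.ball x r) ≤
      ENNReal.ofReal (2 * r') * ∫⁻ y in Metric.ball x' r', G y := by
  -- the centre `z` of the dilation with ratio `r' / r` that maps `x` to `x'`
  set z := x - (r / (r' - r)) • (x' - x) with hz
  set lam := r' / r with hlamdef
  have hsub : 0 < r' - r := by linarith
  have hlam : 1 ≤ lam := by rw [hlamdef, one_le_div hr]; exact hrr'.le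
  have hxz : x - z = (r / (r' - r)) • (x' - x) := by rw [hz]; abel
  have hxzn : ‖x - z‖ ≤ r := by
    rw [hxz, norm_smul, Real.norm_of_nonneg (by positivity), ← dist_eq_norm, dist_comm]
    calc r / (r' - r) * dist x x' ≤ r / (r' - r) * (r' - r) := by gcongr
      _ = r := by field_simp
  have hx' : z + lam • (x - z) = x' := by
    have h1 : lam * (r / (r' - r)) = 1 + r / (r' - r) := by
      rw [hlamdef]; field_simp; ring
    rw [hxz, smul_smul, h1, hz, add_smul, one_smul]
    abel
  have hlr : lam * r = r' := by rw [hlamdef]; field_simp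
  have hb := h.bound z x r lam hr hlam
  rw [hx', hlr] at hb
  refine hb.trans ?_
  have hmeas : Measurable fun q : EuclideanSpace ℝ (Fin d) × ℝ => G (z + q.2 • (q.1 - z)) :=
    h.measurable.comp (by fun_prop)
  calc _ ≤ ∫⁻ y in Metric.ball x r, ∫⁻ s in Ioc 1 lam,
        G (z + s • (y - z)) * ENNReal.ofReal (2 * r) := by
        refine setLIntegral_mono' measurableSet_ball fun y hy => ?_
        refine lintegral_mono fun s => ?_
        refine mul_le_mul_right ?_ _
        rw [← ofReal_norm]
        refine ENNReal.ofReal_le_ofReal ?_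
        linarith [norm_sub_le_of_mem_ball hy hxzn]
    _ = ∫⁻ s in Ioc 1 lam, ∫⁻ y in Metric.ball x r,
        G (z + s • (y - z)) * ENNReal.ofReal (2 * r) := by
        have hsw := lintegral_lintegral_swap (μ := volume.restrict (Metric.ball x r))
          (ν := volume.restrict (Ioc 1 lam)) (f := fun y s =>
            G (z + s • (y - z)) * ENNReal.ofReal (2 * r))
          (hmeas.mul_const (ENNReal.ofReal (2 * r))).aemeasurable
        exact hsw
    _ ≤ ∫⁻ s in Ioc 1 lam, (∫⁻ y in Metric.ball x' r', G y) * ENNReal.ofReal (2 * r) := by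
        refine setLIntegral_mono' measurableSet_Ioc fun s hs => ?_
        rw [lintegral_mul_const' _ _ ENNReal.ofReal_ne_top]
        refine mul_le_mul_left ?_ _
        refine setLIntegral_comp_dilation_le G z hs.1.le measurableSet_ball measurableSet_ball
          fun y hy => ?_
        rw [Metric.mem_ball, dist_eq_norm] at hy ⊢
        have hs0 : 0 ≤ s := by linarith [hs.1]
        calc ‖z + s • (y - z) - x'‖ = ‖s • (y - x) - (lam - s) • (x - z)‖ := by
              rw [← hx']; congr 1; module
          _ ≤ ‖s • (y - x)‖ + ‖(lam - s) • (x - z)‖ := norm_sub_le _ _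
          _ = s * ‖y - x‖ + (lam - s) * ‖x - z‖ := by
              rw [norm_smul, norm_smul, Real.norm_of_nonneg hs0,
                Real.norm_of_nonneg (by linarith [hs.2])]
          _ < s * r + (lam - s) * r := by
              refine add_lt_add_of_lt_of_le ?_ ?_
              · exact mul_lt_mul_of_pos_left hy (by linarith [hs.1])
              · exact mul_le_mul_of_nonneg_left hxzn (by linarith [hs.2])
          _ = r' := by rw [← hlr]; ring
    _ = ENNReal.ofReal (2 * r * (lam - 1)) * ∫⁻ y in Metric.ball x' r', G y := by
        rw [setLIntegral_const, Real.volume_Ioc,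
          ENNReal.ofReal_mul (p := 2 * r) (q := lam - 1) (by positivity)]
        ring
    _ ≤ _ := by
        refine mul_le_mul_left (ENNReal.ofReal_le_ofReal ?_) _
        nlinarith

/-- A Lebesgue point argument: the value of `u` is the limit of dyadic averages, whose successive
differences are controlled by `G`. -/
theorem DilationBound.ae_enorm_sub_ballAverage_le (h : DilationBound u G)
    (hu : LocallyIntegrable u volume) {δ : ℝ} (hδ : 0 < δ) :
    ∀ᵐ y, ‖u y - ballAverage u y δ‖ₑ ≤ ∑' j : ℕ, ENNReal.ofReal (2 ^ (d + 1) * (δ * (1 / 2) ^ j)) *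
      ((∫⁻ z in Metric.ball y (δ * (1 / 2) ^ j), G z) /
        volume (Metric.ball y (δ * (1 / 2) ^ j))) := by
  filter_upwards [(Besicovitch.vitaliFamily
    (volume : Measure (EuclideanSpace ℝ (Fin d)))).ae_tendsto_average hu] with y hy
  have h1 : Tendsto (fun j : ℕ => δ * (1 / 2) ^ j) atTop (𝓝[>] 0) := by
    refine tendsto_nhdsWithin_iff.2 ⟨?_, Eventually.of_forall fun j => by
      simp only [mem_Ioi]; positivity⟩
    simpa using (tendsto_pow_atTop_nhds_zero_of_lt_one (r := (1 / 2 : ℝ))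
      (by norm_num) (by norm_num)).const_mul δ
  have h2 : Tendsto (fun j : ℕ => ballAverage u y (δ * (1 / 2) ^ j)) atTop (𝓝 (u y)) := by
    refine (hy.comp ((Besicovitch.tendsto_filterAt _ y).comp h1)).congr fun j => ?_
    exact (setAverage_congr (ball_ae_eq_closedBall y (by positivity))).symm
  have h3 := edist_le_tsum_of_edist_le_of_tendsto₀ (fun j : ℕ =>
      ENNReal.ofReal (2 ^ (d + 1) * (δ * (1 / 2) ^ j)) *
      ((∫⁻ z in Metric.ball y (δ * (1 / 2) ^ j), G z) /
        volume (Metric.ball y (δ * (1 / 2) ^ j)))) (fun j => ?_) h2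
  · rw [pow_zero, mul_one, edist_comm, edist_eq_enorm_sub] at h3
    exact h3
  · rw [edist_comm, edist_eq_enorm_sub]
    set ρ := δ * (1 / 2) ^ j with hρ
    have hρ0 : 0 < ρ := by positivity
    have hρ' : δ * (1 / 2) ^ j.succ = 1 / 2 * ρ := by rw [hρ, pow_succ]; ring
    rw [hρ']
    have hV0 : volume (Metric.ball y ρ) ≠ 0 := (Metric.measure_ball_pos volume y hρ0).ne'
    have hV : volume (Metric.ball y ρ) ≠ ⊤ := measure_ball_lt_top.ne
    have h4 := h.enorm_sub_mul_le (x := y) (x' := y) (r := 1 / 2 * ρ) (r' := ρ) (by positivity)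
      (by linarith) (by rw [dist_self]; linarith)
    rw [volume_ball_mul y y (by norm_num) ρ] at h4
    have h5 : ENNReal.ofReal ((1 / 2) ^ d) ≠ 0 := by
      rw [Ne, ENNReal.ofReal_eq_zero, not_le]; positivity
    rw [← ENNReal.mul_le_mul_iff_left (mul_ne_zero h5 hV0)
      (ENNReal.mul_ne_top ENNReal.ofReal_ne_top hV)]
    refine h4.trans_eq ?_
    calc ENNReal.ofReal (2 * ρ) * ∫⁻ z in Metric.ball y ρ, G z
        = (ENNReal.ofReal (2 ^ (d + 1) * ρ) * ENNReal.ofReal ((1 / 2) ^ d)) *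
          ((∫⁻ z in Metric.ball y ρ, G z) / volume (Metric.ball y ρ) *
            volume (Metric.ball y ρ)) := by
          rw [ENNReal.div_mul_cancel hV0 hV, ← ENNReal.ofReal_mul (by positivity)]
          congr 2
          rw [pow_succ, one_div, inv_pow]
          field_simp
      _ = _ := by ring

end

/-! ### The limit at infinity of averages over balls -/

section

variable {d : ℕ} {p : ℝ} {w u : EuclideanSpace ℝ (Fin d) → ℝ}
  {G : EuclideanSpace ℝ (Fin d) → ℝ≥0∞}

/-- Nested balls with radii `r < r'`: for bounded `r' / r` the increment of the average decays like
`r'^{1 - d/p}`, as for Lebesgue measure. -/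
theorem DilationBound.exists_enorm_ballAverage_sub_le (hD : DilationBound u G) (hp : 1 ≤ p)
    (hw : IsMuckenhoupt p w) (h : 0 < ⨅ x, weightedMeasure w (cube x 1)) :
    ∃ C : ℝ≥0, ∀ (x x' : EuclideanSpace ℝ (Fin d)) (r r' : ℝ), 0 < r → r < r' → 1 ≤ r' →
      dist x x' ≤ r' - r → ‖ballAverage u x r - ballAverage u x' r'‖ₑ ≤
        C * ENNReal.ofReal ((r' / r) ^ d * r' ^ (1 - d / p)) *
          (∫⁻ y in Metric.ball x' r', G y ^ p ∂(weightedMeasure w)) ^ (1 / p) := by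
  obtain ⟨C, hC⟩ := hw.exists_setLIntegral_le hp h one_pos
  have hB0 : volume (Metric.ball (0 : EuclideanSpace ℝ (Fin d)) 1) ≠ 0 :=
    (Metric.measure_ball_pos volume _ one_pos).ne'
  have hB : volume (Metric.ball (0 : EuclideanSpace ℝ (Fin d)) 1) ≠ ⊤ := measure_ball_lt_top.ne
  obtain ⟨β, hβ⟩ : ∃ β : ℝ≥0, (β : ℝ≥0∞) =
      volume (Metric.ball (0 : EuclideanSpace ℝ (Fin d)) 1) := ⟨_, ENNReal.coe_toNNReal hB⟩
  have hβ0 : (β : ℝ≥0∞) ≠ 0 := by rwa [hβ]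
  refine ⟨2 * C / β, fun x x' r r' hr hrr' hr1 hx => ?_⟩
  have h1 := hD.enorm_sub_mul_le hr hrr' hx
  have h2 := hC x' r' hr1 G hD.measurable.aemeasurable
  set N := (∫⁻ y in Metric.ball x' r', G y ^ p ∂(weightedMeasure w)) ^ (1 / p)
  have hV0 : volume (Metric.ball x r) ≠ 0 := (Metric.measure_ball_pos volume x hr).ne'
  have hV : volume (Metric.ball x r) ≠ ⊤ := measure_ball_lt_top.ne
  have hVe : volume (Metric.ball x r) = ENNReal.ofReal (r ^ d) * β := by
    rw [hβ]
    simpa using volume_ball_mul x 0 hr 1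
  have hr0 : 0 < r' := by linarith
  rw [← ENNReal.mul_le_mul_iff_left hV0 hV]
  refine (h1.trans (mul_le_mul_right h2 _)).trans_eq ?_
  have e1 : ENNReal.ofReal (2 * r') * ENNReal.ofReal (r' ^ (d - d / p)) =
      2 * (ENNReal.ofReal ((r' / r) ^ d * r' ^ (1 - d / p)) * ENNReal.ofReal (r ^ d)) := by
    rw [← ENNReal.ofReal_mul (by positivity), ← ENNReal.ofReal_mul (by positivity)]
    have : (2 : ℝ≥0∞) = ENNReal.ofReal 2 := by simp
    rw [this, ← ENNReal.ofReal_mul (by positivity)]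
    congr 1
    have e2 : r' * r' ^ (d - d / p) = r' ^ d * r' ^ (1 - d / p) := by
      rw [← Real.rpow_natCast r' d, ← Real.rpow_add hr0]
      nth_rewrite 1 [← Real.rpow_one r']
      rw [← Real.rpow_add hr0]
      congr 1
      ring
    rw [mul_assoc, e2, div_pow]
    field_simp
  rw [hVe, ENNReal.coe_div (by exact_mod_cast hβ0)]
  calc _ = (ENNReal.ofReal (2 * r') * ENNReal.ofReal (r' ^ (d - d / p))) * C * N := by ring
    _ = 2 * (ENNReal.ofReal ((r' / r) ^ d * r' ^ (1 - d / p)) * ENNReal.ofReal (r ^ d)) * C * N *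
        (β / β) := by rw [e1, ENNReal.div_self hβ0 ENNReal.coe_ne_top, mul_one]
    _ = _ := by
        simp only [div_eq_mul_inv]
        push_cast
        ring

theorem tendsto_setLIntegral_compl_ball {μ : Measure (EuclideanSpace ℝ (Fin d))}
    {f : EuclideanSpace ℝ (Fin d) → ℝ≥0∞} (hfi : ∫⁻ x, f x ∂μ ≠ ⊤) :
    Tendsto (fun R : ℝ => ∫⁻ x in (Metric.ball 0 R)ᶜ, f x ∂μ) atTop (𝓝 0) := by
  have h1 : Tendsto (μ.withDensity f ∘ fun R : ℝ => (Metric.ball 0 R)ᶜ) atTop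
      (𝓝 (μ.withDensity f (⋂ R : ℝ, (Metric.ball 0 R)ᶜ))) := by
    refine tendsto_measure_iInter_atTop (fun R => measurableSet_ball.compl.nullMeasurableSet)
      (fun a b hab => compl_subset_compl.2 (Metric.ball_subset_ball hab)) ⟨0, ?_⟩
    refine ((measure_mono (subset_univ _)).trans_lt ?_).ne
    rw [withDensity_apply _ MeasurableSet.univ, setLIntegral_univ]
    exact hfi.lt_top
  have h2 : (⋂ R : ℝ, (Metric.ball (0 : EuclideanSpace ℝ (Fin d)) R)ᶜ) = ∅ := by
    refine eq_empty_of_forall_notMem fun x hx => ?_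
    have := mem_iInter.1 hx (‖x‖ + 1)
    simp at this
  rw [h2, measure_empty] at h1
  refine h1.congr fun R => ?_
  simp only [Function.comp]
  rw [withDensity_apply _ measurableSet_ball.compl]

/-- The averages of `u` over large balls, and over balls of a fixed radius that move to infinity,
tend to one and the same constant. -/
theorem DilationBound.exists_tendsto_ballAverage (hD : DilationBound u G) (hp : 1 ≤ p)
    (hpd : p < d) (hw : IsMuckenhoupt p w) (h : 0 < ⨅ x, weightedMeasure w (cube x 1))
    (hG : ∫⁻ x, G x ^ p ∂(weightedMeasure w) < ⊤) :
    ∃ c : ℝ, (∀ (x : ℕ → EuclideanSpace ℝ (Fin d)) (ρ L : ℝ), 0 < ρ → (∀ k, ‖x k‖ ≤ 2 ^ k * L) →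
      Tendsto (fun k => ballAverage u (x k) (2 ^ k * ρ)) atTop (𝓝 c)) ∧
      ∀ ρ > 0, ∀ ε > 0, ∃ R : ℝ, ∀ x, R ≤ ‖x‖ → |ballAverage u x ρ - c| ≤ ε := by
  obtain ⟨C, hC⟩ := hD.exists_enorm_ballAverage_sub_le hp hw h
  have hp0 : 0 < p := by linarith
  have hp1 : 0 < 1 / p := by positivity
  set e : ℝ := 1 - d / p with he
  have he0 : e < 0 := by
    rw [he, sub_neg, lt_div_iff₀ hp0]; linarith
  set N := (∫⁻ x, G x ^ p ∂(weightedMeasure w)) ^ (1 / p) with hN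
  have hNtop : N ≠ ⊤ := ENNReal.rpow_ne_top_of_nonneg hp1.le hG.ne
  set D : ℝ := C * N.toReal with hDdef
  have hD0 : 0 ≤ D := by positivity
  have hdist : ∀ (x x' : EuclideanSpace ℝ (Fin d)) (r r' : ℝ), 0 < r → r < r' → 1 ≤ r' →
      dist x x' ≤ r' - r →
      dist (ballAverage u x r) (ballAverage u x' r') ≤ D * ((r' / r) ^ d * r' ^ e) := by
    intro x x' r r' hr hrr' hr1 hx
    have hr0 : 0 < r' := by linarith
    rw [← edist_le_ofReal (by positivity), edist_eq_enorm_sub]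
    refine (hC x x' r r' hr hrr' hr1 hx).trans ?_
    rw [ENNReal.ofReal_mul (p := D) (by positivity), hDdef,
      ENNReal.ofReal_mul (p := (C : ℝ)) (by positivity),
      ENNReal.ofReal_toReal hNtop, ENNReal.ofReal_coe_nnreal, mul_right_comm]
    gcongr
    exact ENNReal.rpow_le_rpow (setLIntegral_le_lintegral _ _) hp1.le
  -- the ratio of the geometric series of dyadic increments
  set q : ℝ := 2 ^ e with hq
  have hq0 : 0 < q := by positivity
  have hq1 : q < 1 := Real.rpow_lt_one_of_one_lt_of_neg one_lt_two he0
  have hpow (k : ℕ) : ((2 : ℝ) ^ k) ^ e = q ^ k := by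
    rw [hq, ← Real.rpow_natCast, ← Real.rpow_natCast, ← Real.rpow_mul (by norm_num),
      ← Real.rpow_mul (by norm_num), mul_comm]
  have hgeo : ∀ (x : EuclideanSpace ℝ (Fin d)) (ρ : ℝ), 1 ≤ ρ → ∀ k : ℕ,
      dist (ballAverage u x (2 ^ k * ρ)) (ballAverage u x (2 ^ (k + 1) * ρ)) ≤
        (D * 2 ^ d * ρ ^ e) * q ^ k := by
    intro x ρ hρ k
    have hρ0 : 0 < ρ := by linarith
    have h2k : (1 : ℝ) ≤ 2 ^ k := one_le_pow₀ one_le_two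
    have hk1 : (2 : ℝ) ^ (k + 1) = 2 * 2 ^ k := by ring
    refine (hdist x x _ _ (by positivity) ?_ ?_ ?_).trans ?_
    · rw [hk1]; nlinarith
    · rw [hk1]; nlinarith
    · rw [dist_self, hk1]; nlinarith
    · have e1 : (2 : ℝ) ^ (k + 1) * ρ / (2 ^ k * ρ) = 2 := by rw [hk1]; field_simp
      rw [e1, Real.mul_rpow (by positivity) hρ0.le, hpow]
      have : q ^ (k + 1) ≤ q ^ k := pow_le_pow_of_le_one hq0.le hq1.le (Nat.le_succ k)
      calc D * (2 ^ d * (q ^ (k + 1) * ρ ^ e)) ≤ D * (2 ^ d * (q ^ k * ρ ^ e)) := by gcongr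
        _ = _ := by ring
  obtain ⟨c, hc⟩ := cauchySeq_tendsto_of_complete
    (cauchySeq_of_le_geometric q _ hq1 (hgeo 0 1 le_rfl))
  simp only [mul_one] at hc
  have hfirst : ∀ (x : ℕ → EuclideanSpace ℝ (Fin d)) (ρ L : ℝ), 0 < ρ →
      (∀ k, ‖x k‖ ≤ 2 ^ k * L) →
      Tendsto (fun k => ballAverage u (x k) (2 ^ k * ρ)) atTop (𝓝 c) := by
    intro x ρ L hρ hx
    -- `B(x k, 2 ^ k * ρ)` lies in the ball of radius `2 ^ (k + j)` about the origin
    obtain ⟨j, hj⟩ := pow_unbounded_of_one_lt (L + ρ) one_lt_two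
    have hL : 0 ≤ L := by simpa using (norm_nonneg _).trans (hx 0)
    have h1 : Tendsto (fun k => ballAverage u 0 (2 ^ (k + j))) atTop (𝓝 c) :=
      hc.comp (tendsto_add_atTop_nat j)
    refine tendsto_of_tendsto_of_dist h1 ?_
    refine squeeze_zero (g := fun k => D * ((2 ^ j / ρ) ^ d * q ^ j) * q ^ k)
      (fun _ => dist_nonneg) (fun k => ?_) ?_
    · rw [dist_comm]
      have h2k : (0 : ℝ) < 2 ^ k := by positivity
      have e0 : (2 : ℝ) ^ (k + j) = 2 ^ k * 2 ^ j := pow_add _ _ _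
      refine (hdist (x k) 0 (2 ^ k * ρ) (2 ^ (k + j)) (by positivity) ?_
        (one_le_pow₀ one_le_two) ?_).trans_eq ?_
      · rw [e0]; nlinarith
      · rw [dist_zero_right, e0]; nlinarith [hx k]
      · have e1 : (2 : ℝ) ^ (k + j) / (2 ^ k * ρ) = 2 ^ j / ρ := by rw [e0]; field_simp
        rw [e1, hpow]
        ring
    · simpa using (tendsto_pow_atTop_nhds_zero_of_lt_one hq0.le hq1).const_mul
        (D * ((2 ^ j / ρ) ^ d * q ^ j))
  refine ⟨c, hfirst, fun ρ hρ ε hε => ?_⟩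
  -- first the average over `B(x, ρ)` is compared with the one over a ball of large radius `ρ'`
  have hlim : Tendsto (fun ρ' : ℝ => D * 2 ^ d * ρ' ^ e / (1 - q)) atTop (𝓝 0) := by
    have h1 : Tendsto (fun ρ' : ℝ => ρ' ^ e) atTop (𝓝 0) := by
      simpa using tendsto_rpow_neg_atTop (neg_pos.2 he0)
    simpa using (h1.const_mul (D * 2 ^ d)).div_const (1 - q)
  obtain ⟨ρ', hρ'ε, hρ'⟩ := ((hlim.eventually (eventually_le_nhds (half_pos hε))).and
    (eventually_ge_atTop (ρ + 1))).exists
  have hρ'1 : 1 ≤ ρ' := by linarith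
  set A : ℝ≥0∞ := C * ENNReal.ofReal ((ρ' / ρ) ^ d * ρ' ^ e) with hA
  have hAtop : A ≠ ⊤ := ENNReal.mul_ne_top ENNReal.coe_ne_top ENNReal.ofReal_ne_top
  have hlim2 : Tendsto (fun R : ℝ => A * (∫⁻ y in (Metric.ball 0 R)ᶜ, G y ^ p
      ∂(weightedMeasure w)) ^ (1 / p)) atTop (𝓝 0) := by
    have h1 := (tendsto_setLIntegral_compl_ball hG.ne).ennrpow_const (1 / p)
    rw [ENNReal.zero_rpow_of_pos hp1] at h1
    simpa using ENNReal.Tendsto.const_mul h1 (Or.inr hAtop)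
  have hε2 : (0 : ℝ≥0∞) < ENNReal.ofReal (ε / 2) := by simpa using hε
  obtain ⟨R, hR⟩ := (hlim2.eventually (eventually_le_nhds hε2)).exists
  refine ⟨R + ρ', fun x hx => ?_⟩
  have h1 : dist (ballAverage u x ρ) (ballAverage u x ρ') ≤ ε / 2 := by
    rw [← edist_le_ofReal (by positivity), edist_eq_enorm_sub]
    refine (hC x x ρ ρ' hρ (by linarith) hρ'1 (by rw [dist_self]; linarith)).trans
      (le_trans ?_ hR)
    have hsub : Metric.ball x ρ' ⊆ (Metric.ball 0 R)ᶜ := by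
      intro y hy hy'
      rw [Metric.mem_ball, dist_eq_norm] at hy
      rw [mem_ball_zero_iff] at hy'
      have h3 : ‖x‖ ≤ ‖y‖ + ‖y - x‖ := by
        calc ‖x‖ = ‖y - (y - x)‖ := by congr 1; abel
          _ ≤ _ := norm_sub_le _ _
      linarith
    rw [hA]
    gcongr
  have h2 : dist (ballAverage u x ρ') c ≤ ε / 2 := by
    have h3 := dist_le_of_le_geometric_of_tendsto₀ q _ hq1 (hgeo x ρ' hρ'1)
      (hfirst (fun _ => x) ρ' ‖x‖ (by linarith) fun k =>
        le_mul_of_one_le_left (norm_nonneg _) (one_le_pow₀ one_le_two))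
    rw [pow_zero, one_mul] at h3
    exact h3.trans hρ'ε
  rw [← Real.dist_eq]
  linarith [dist_triangle (ballAverage u x ρ) (ballAverage u x ρ') c]

/-! ### Weighted averages over cubes -/

theorem measurable_setLIntegral_ball_div {f : EuclideanSpace ℝ (Fin d) → ℝ≥0∞}
    (hf : Measurable f) (r : ℝ) : Measurable fun y =>
      (∫⁻ z in Metric.ball y r, f z) / volume (Metric.ball y r) := by
  have hS : MeasurableSet {q : EuclideanSpace ℝ (Fin d) × EuclideanSpace ℝ (Fin d) |
      dist q.2 q.1 < r} := measurableSet_lt (by fun_prop) measurable_const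
  have h1 : Measurable fun y => ∫⁻ z in Metric.ball y r, f z := by
    have h2 : Measurable fun y => ∫⁻ z,
        {q : EuclideanSpace ℝ (Fin d) × EuclideanSpace ℝ (Fin d) | dist q.2 q.1 < r}.indicator
          (fun q => f q.2) (y, z) :=
      ((hf.comp measurable_snd).indicator hS).lintegral_prod_right'
    convert h2 using 2 with y
    rw [← lintegral_indicator measurableSet_ball]
    rfl
  exact h1.div (measurable_measure_prodMk_left hS)

/-- Averages of `f` over balls of radius `r` are bounded from `L^p(μ)` to `L^1(μ)`, uniformly in
`r`: the `A_p`-condition, Fubini's theorem and the doubling property of `μ`. -/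
theorem IsMuckenhoupt.exists_setLIntegral_average_le (hp : 1 ≤ p) (hw : IsMuckenhoupt p w) :
    ∃ C : ℝ≥0, ∀ r : ℝ, 0 < r → ∀ Q : Set (EuclideanSpace ℝ (Fin d)), MeasurableSet Q →
      ∀ f : EuclideanSpace ℝ (Fin d) → ℝ≥0∞, Measurable f →
      ∫⁻ y in Q, (∫⁻ z in Metric.ball y r, f z) / volume (Metric.ball y r)
          ∂(weightedMeasure w) ≤
        C * weightedMeasure w Q ^ (1 - 1 / p) *
          (∫⁻ z in Metric.thickening r Q, f z ^ p ∂(weightedMeasure w)) ^ (1 / p) := by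
  obtain ⟨C, hC⟩ := hw.exists_lintegral_rpow_mul_le hp
  obtain ⟨D, hD⟩ := hw.exists_measure_ball_le hp two_pos
  have hp0 : 0 < p := by linarith
  refine ⟨(C * D) ^ (1 / p), fun r hr Q hQ f hf => ?_⟩
  set μ := weightedMeasure w with hμdef
  have hμ0 (y) : μ (Metric.ball y r) ≠ 0 := (hw.measure_ball_pos y hr).ne'
  have hμt (y) : μ (Metric.ball y r) ≠ ⊤ := (hw.measure_lt_top Metric.isBounded_ball).ne
  have hS : MeasurableSet {q : EuclideanSpace ℝ (Fin d) × EuclideanSpace ℝ (Fin d) |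
      dist q.2 q.1 < r} :=
    measurableSet_lt (by fun_prop) measurable_const
  have hμm : Measurable fun z => μ (Metric.ball z r) := measurable_measure_prodMk_left hS
  -- by doubling, `μ (B(y, r))` is comparable to `μ (B(z, r))` for `z ∈ B(y, r)`; with the latter
  -- as the weight, the integration over `y` in `hfub` cancels it
  set F : EuclideanSpace ℝ (Fin d) → ℝ≥0∞ := fun z => f z ^ p * (μ (Metric.ball z r))⁻¹ with hF
  have hFm : Measurable F := (hf.pow_const p).mul hμm.inv
  have hm := measurable_setLIntegral_ball_div hf r
  have hpt (y : EuclideanSpace ℝ (Fin d)) :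
      ((∫⁻ z in Metric.ball y r, f z) / volume (Metric.ball y r)) ^ p ≤
        (C * D : ℝ≥0) * ∫⁻ z in Metric.ball y r, F z ∂μ := by
    have hV0 : volume (Metric.ball y r) ≠ 0 := (Metric.measure_ball_pos volume y hr).ne'
    have hV : volume (Metric.ball y r) ≠ ⊤ := measure_ball_lt_top.ne
    have h1 := hC y r hr f hf.aemeasurable
    have h2 : ((∫⁻ z in Metric.ball y r, f z) / volume (Metric.ball y r)) ^ p ≤
        C * ((∫⁻ z in Metric.ball y r, f z ^ p ∂μ) * (μ (Metric.ball y r))⁻¹) := by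
      rw [ENNReal.div_rpow_of_nonneg _ _ hp0.le, ENNReal.div_le_iff (by simp [hV0, hV])
        (by simp [hV0, hV]), ← ENNReal.mul_le_mul_iff_left (hμ0 y) (hμt y)]
      refine h1.trans_eq ?_
      calc _ = C * volume (Metric.ball y r) ^ p * (∫⁻ z in Metric.ball y r, f z ^ p ∂μ) *
            ((μ (Metric.ball y r))⁻¹ * μ (Metric.ball y r)) := by
            rw [ENNReal.inv_mul_cancel (hμ0 y) (hμt y), mul_one]
        _ = _ := by ring
    refine h2.trans ?_
    rw [ENNReal.coe_mul, mul_assoc]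
    refine mul_le_mul_right ?_ _
    rw [← lintegral_mul_const' _ _ (ENNReal.inv_ne_top.2 (hμ0 y)),
      ← lintegral_const_mul' _ _ ENNReal.coe_ne_top]
    refine setLIntegral_mono' measurableSet_ball fun z hz => ?_
    have h3 : μ (Metric.ball z r) ≤ D * μ (Metric.ball y r) := by
      refine (measure_mono (Metric.ball_subset_ball (by linarith))).trans
        (hD y z r hr fun a ha => ?_)
      rw [Metric.mem_ball] at ha hz ⊢
      rw [dist_comm] at hz
      linarith [dist_triangle a y z]
    have h4 : (μ (Metric.ball y r))⁻¹ ≤ D * (μ (Metric.ball z r))⁻¹ := by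
      calc (μ (Metric.ball y r))⁻¹
          = (μ (Metric.ball y r))⁻¹ * (μ (Metric.ball z r) * (μ (Metric.ball z r))⁻¹) := by
            rw [ENNReal.mul_inv_cancel (hμ0 z) (hμt z), mul_one]
        _ ≤ (μ (Metric.ball y r))⁻¹ * ((D * μ (Metric.ball y r)) * (μ (Metric.ball z r))⁻¹) := by
            gcongr
        _ = D * (μ (Metric.ball z r))⁻¹ * ((μ (Metric.ball y r))⁻¹ * μ (Metric.ball y r)) := by
            ring
        _ = _ := by rw [ENNReal.inv_mul_cancel (hμ0 y) (hμt y), mul_one]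
    calc f z ^ p * (μ (Metric.ball y r))⁻¹ ≤ f z ^ p * (D * (μ (Metric.ball z r))⁻¹) := by gcongr
      _ = _ := by rw [hF]; ring
  have hfub : ∫⁻ y in Q, ∫⁻ z in Metric.ball y r, F z ∂μ ∂μ ≤
      ∫⁻ z in Metric.thickening r Q, f z ^ p ∂μ := by
    set S := {q : EuclideanSpace ℝ (Fin d) × EuclideanSpace ℝ (Fin d) | dist q.2 q.1 < r} with hSd
    calc _ = ∫⁻ y in Q, ∫⁻ z, S.indicator (fun q => F q.2) (y, z) ∂μ ∂μ := by
          refine lintegral_congr fun y => ?_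
          rw [← lintegral_indicator measurableSet_ball]
          rfl
      _ = ∫⁻ z, ∫⁻ y in Q, S.indicator (fun q => F q.2) (y, z) ∂μ ∂μ := by
          have := lintegral_lintegral_swap (μ := μ.restrict Q) (ν := μ)
            (f := fun y z => S.indicator (fun q => F q.2) (y, z))
            ((hFm.comp measurable_snd).indicator hS).aemeasurable
          exact this
      _ ≤ ∫⁻ z, (Metric.thickening r Q).indicator (fun z => f z ^ p) z ∂μ := by
          refine lintegral_mono fun z => ?_
          by_cases hz : z ∈ Metric.thickening r Q
          · rw [indicator_of_mem hz]
            calc _ ≤ ∫⁻ y, S.indicator (fun q => F q.2) (y, z) ∂μ := setLIntegral_le_lintegral _ _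
              _ = ∫⁻ y in Metric.ball z r, F z ∂μ := by
                  rw [← lintegral_indicator measurableSet_ball]
                  refine lintegral_congr fun y => ?_
                  simp only [indicator, hSd, mem_ofPred_eq, Metric.mem_ball, dist_comm z y]
              _ = f z ^ p := by
                  rw [setLIntegral_const, hF]
                  simp only
                  rw [mul_assoc, ENNReal.inv_mul_cancel (hμ0 z) (hμt z), mul_one]
          · refine le_of_eq_of_le (setLIntegral_eq_zero hQ fun y hy => ?_) (zero_le (α := ℝ≥0∞))
            refine indicator_of_notMem (fun hyz => hz ?_) _
            exact Metric.mem_thickening_iff.2 ⟨y, hy, hyz⟩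
      _ = _ := lintegral_indicator Metric.isOpen_thickening.measurableSet _
  -- Jensen's inequality on `Q`
  have hJ := eLpNorm'_le_eLpNorm'_mul_rpow_measure_univ (μ := μ.restrict Q) one_pos hp
    hm.aestronglyMeasurable
  simp only [eLpNorm'_eq_lintegral_enorm, enorm_eq_self, ENNReal.rpow_one, div_one,
    Measure.restrict_apply_univ] at hJ
  refine hJ.trans ?_
  rw [mul_right_comm]
  refine mul_le_mul_left ?_ _
  rw [ENNReal.coe_rpow_of_nonneg _ (by positivity),
    ← ENNReal.mul_rpow_of_nonneg _ _ (by positivity)]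
  refine ENNReal.rpow_le_rpow ?_ (by positivity)
  calc _ ≤ ∫⁻ y in Q, (C * D : ℝ≥0) * ∫⁻ z in Metric.ball y r, F z ∂μ ∂μ :=
        lintegral_mono fun y => hpt y
    _ ≤ _ := by
        rw [lintegral_const_mul' _ _ ENNReal.coe_ne_top]
        gcongr

/-- Poincaré's inequality for `μ`, with the averages over the balls `B(y, δ)` in place of one
average: the dyadic increments decay geometrically. -/
theorem DilationBound.exists_setLIntegral_enorm_sub_le (hD : DilationBound u G)
    (hu : LocallyIntegrable u volume) (hp : 1 ≤ p) (hw : IsMuckenhoupt p w) {δ : ℝ} (hδ : 0 < δ) :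
    ∃ C : ℝ≥0, ∀ Q : Set (EuclideanSpace ℝ (Fin d)), MeasurableSet Q →
      ∫⁻ y in Q, ‖u y - ballAverage u y δ‖ₑ ∂(weightedMeasure w) ≤
        C * weightedMeasure w Q ^ (1 - 1 / p) *
          (∫⁻ z in Metric.thickening δ Q, G z ^ p ∂(weightedMeasure w)) ^ (1 / p) := by
  obtain ⟨C, hC⟩ := hw.exists_setLIntegral_average_le hp
  refine ⟨Real.toNNReal (2 ^ (d + 1) * δ * 2) * C, fun Q hQ => ?_⟩
  have hae := weightedMeasure_absolutelyContinuous w (hD.ae_enorm_sub_ballAverage_le hu hδ)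
  refine (lintegral_mono_ae (ae_restrict_of_ae hae)).trans ?_
  rw [lintegral_tsum fun j =>
    ((measurable_setLIntegral_ball_div hD.measurable _).const_mul _).aemeasurable]
  set X := weightedMeasure w Q ^ (1 - 1 / p) *
    (∫⁻ z in Metric.thickening δ Q, G z ^ p ∂(weightedMeasure w)) ^ (1 / p) with hX
  calc _ ≤ ∑' j : ℕ, ENNReal.ofReal (2 ^ (d + 1) * δ * (1 / 2) ^ j) * (C * X) := by
        refine ENNReal.tsum_le_tsum fun j => ?_
        have hj : δ * (1 / 2) ^ j ≤ δ :=
          mul_le_of_le_one_right hδ.le (pow_le_one₀ (by norm_num) (by norm_num))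
        rw [lintegral_const_mul' _ _ ENNReal.ofReal_ne_top, mul_assoc (2 ^ (d + 1))]
        refine mul_le_mul_right ((hC _ (by positivity) Q hQ G hD.measurable).trans ?_) _
        rw [hX, mul_assoc]
        refine mul_le_mul_right (mul_le_mul_right (ENNReal.rpow_le_rpow ?_ (by positivity)) _) _
        exact lintegral_mono_set (Metric.thickening_mono hj Q)
    _ = _ := by
        rw [ENNReal.tsum_mul_right, ← ENNReal.ofReal_tsum_of_nonneg (fun j => by positivity)
          (summable_geometric_two.mul_left _), tsum_mul_left, tsum_geometric_two, hX,
          ENNReal.coe_mul]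
        simp only [ENNReal.ofReal, mul_assoc]

theorem enorm_setAverage_sub_mul_le {μ : Measure (EuclideanSpace ℝ (Fin d))}
    {Q : Set (EuclideanSpace ℝ (Fin d))} (hQ0 : μ Q ≠ 0) (hQ : μ Q ≠ ⊤) (hu : IntegrableOn u Q μ)
    (c : ℝ) :
    ‖(⨍ y in Q, u y ∂μ) - c‖ₑ * μ Q ≤ ∫⁻ y in Q, ‖u y - c‖ₑ ∂μ := by
  have h1 : (⨍ y in Q, u y ∂μ) - c = (μ.real Q)⁻¹ • ∫ y in Q, (u y - c) ∂μ := by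
    have h2 : μ.real Q ≠ 0 := (ENNReal.toReal_pos hQ0 hQ).ne'
    rw [integral_sub hu (integrableOn_const hQ), setAverage_eq, setIntegral_const, smul_sub,
      smul_smul, inv_mul_cancel₀ h2, one_smul]
  rw [h1, enorm_smul, measureReal_def, Real.enorm_of_nonneg (by positivity),
    ENNReal.ofReal_inv_of_pos (ENNReal.toReal_pos hQ0 hQ), ENNReal.ofReal_toReal hQ, mul_comm,
    ← mul_assoc, ENNReal.mul_inv_cancel hQ0 hQ, one_mul]
  exact enorm_integral_le_lintegral_enorm _

theorem MemHomSobolev.integrableOn (hp : 1 ≤ p) (hw : IsMuckenhoupt p w)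
    (hu : MemHomSobolev p w u) {K : Set (EuclideanSpace ℝ (Fin d))} (hK : IsCompact K) :
    IntegrableOn u K (weightedMeasure w) := by
  have : IsFiniteMeasure ((weightedMeasure w).restrict K) :=
    ⟨by simpa using hw.measure_lt_top hK.isBounded⟩
  refine (hu.memLp_loc K hK).integrable ?_
  simpa using hp

/-- The limit at infinity of averages over balls is the limit of the weighted averages over
cubes. -/
theorem DilationBound.hasCubeLimit (hD : DilationBound u G) (hp : 1 ≤ p)
    (hw : IsMuckenhoupt p w) (h : 0 < ⨅ x, weightedMeasure w (cube x 1))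
    (hG : ∫⁻ x, G x ^ p ∂(weightedMeasure w) < ⊤) (hu : LocallyIntegrable u volume)
    (huK : ∀ K : Set (EuclideanSpace ℝ (Fin d)), IsCompact K →
      IntegrableOn u K (weightedMeasure w)) {c : ℝ}
    (hc : ∀ ρ > 0, ∀ ε > 0, ∃ R : ℝ, ∀ x, R ≤ ‖x‖ → |ballAverage u x ρ - c| ≤ ε) :
    HasCubeLimit w u c := by
  intro x l hl hliminf hinf
  have hp0 : 0 < p := by linarith
  have hp1 : 0 < 1 / p := by positivity
  obtain ⟨δ, hδ0, hδl⟩ := ENNReal.lt_iff_exists_nnreal_btwn.1 hliminf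
  have hδ : (0 : ℝ) < δ := by exact_mod_cast hδ0
  have hle : ∀ᶠ i in atTop, (δ : ℝ) ≤ l i := by
    filter_upwards [eventually_lt_of_lt_liminf hδl] with i hi
    rw [← ENNReal.ofReal_coe_nnreal] at hi
    exact (ENNReal.ofReal_lt_ofReal_iff (hl i)).1 hi |>.le
  obtain ⟨C, hC⟩ := hD.exists_setLIntegral_enorm_sub_le hu hp hw hδ
  obtain ⟨a, ha0, ha⟩ := hw.exists_le_measure_ball hp h (half_pos hδ)
  -- `m` is a lower bound for the mass of cubes of edge length at least `δ`
  set m : ℝ≥0∞ := a * volume (Metric.ball (0 : EuclideanSpace ℝ (Fin d)) (δ / 2)) with hm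
  have hm0 : m ≠ 0 := mul_ne_zero (by exact_mod_cast ha0.ne')
    (Metric.measure_ball_pos volume _ (half_pos hδ)).ne'
  have hmt : m ≠ ⊤ := ENNReal.mul_ne_top ENNReal.coe_ne_top measure_ball_lt_top.ne
  have hmQ : ∀ (y : EuclideanSpace ℝ (Fin d)) (s : ℝ), δ ≤ s →
      m ≤ weightedMeasure w (cube y s) := by
    intro y s hs
    rw [hm, Measure.addHaar_ball_center volume (0 : EuclideanSpace ℝ (Fin d)),
      ← Measure.addHaar_ball_center volume y]
    refine (ha y (δ / 2) le_rfl).trans (measure_mono ?_)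
    exact (Metric.ball_subset_ball (by linarith)).trans (ball_subset_cube y s)
  have hB : (C : ℝ≥0∞) * m ^ (-(1 / p)) ≠ ⊤ :=
    ENNReal.mul_ne_top ENNReal.coe_ne_top (by simp [hm0, hmt])
  have hlim : Tendsto (fun R : ℝ => C * m ^ (-(1 / p)) * (∫⁻ y in (Metric.ball 0 R)ᶜ, G y ^ p
      ∂(weightedMeasure w)) ^ (1 / p)) atTop (𝓝 0) := by
    have h1 := (tendsto_setLIntegral_compl_ball hG.ne).ennrpow_const (1 / p)
    rw [ENNReal.zero_rpow_of_pos hp1] at h1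
    simpa using ENNReal.Tendsto.const_mul h1 (Or.inr hB)
  rw [Metric.tendsto_nhds]
  intro ε hε
  have hε4 : 0 < ε / 4 := by positivity
  obtain ⟨R₁, hR₁⟩ := hc δ hδ (ε / 4) hε4
  have hε2 : (0 : ℝ≥0∞) < ENNReal.ofReal (ε / 4) := by simpa using hε
  obtain ⟨R₂, hR₂⟩ := (hlim.eventually (eventually_le_nhds hε2)).exists
  -- outside this ball `ballAverage u · δ` is close to `c`, and the `δ`-neighbourhood of the cube
  -- stays outside the ball of radius `R₂`
  obtain ⟨N, hN⟩ := hinf (max (max R₁ (R₂ + δ)) 1) (by positivity)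
  filter_upwards [hle, eventually_ge_atTop N] with i hi hiN
  set Q := cube (x i) (l i) with hQdef
  have hfar : ∀ y ∈ Q, max (max R₁ (R₂ + δ)) 1 ≤ ‖y‖ := by
    intro y hy
    by_contra hlt
    have : y ∈ Metric.ball 0 (max (max R₁ (R₂ + δ)) 1) ∩ Q :=
      ⟨mem_ball_zero_iff.2 (not_le.1 hlt), hy⟩
    rw [hN i hiN] at this
    exact this
  have hQ0 : weightedMeasure w Q ≠ 0 :=
    ((pos_iff_ne_zero.2 hm0).trans_le (hmQ _ _ hi)).ne'
  have hQt : weightedMeasure w Q ≠ ⊤ := (hw.measure_lt_top (isCompact_cube _ _).isBounded).ne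
  have h1 := hC Q (measurableSet_cube _ _)
  have h2 : ∫⁻ y in Q, ‖u y - c‖ₑ ∂(weightedMeasure w) ≤
      (∫⁻ y in Q, ‖u y - ballAverage u y δ‖ₑ ∂(weightedMeasure w)) +
        ENNReal.ofReal (ε / 4) * weightedMeasure w Q := by
    rw [← setLIntegral_const, ← lintegral_add_right _ measurable_const]
    refine setLIntegral_mono' (measurableSet_cube _ _) fun y hy => ?_
    have h3 : ‖ballAverage u y δ - c‖ₑ ≤ ENNReal.ofReal (ε / 4) := by
      rw [← ofReal_norm]
      exact ENNReal.ofReal_le_ofReal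
        (hR₁ y ((le_max_left _ _).trans ((le_max_left _ _).trans (hfar y hy))))
    calc ‖u y - c‖ₑ = ‖(u y - ballAverage u y δ) + (ballAverage u y δ - c)‖ₑ := by
          congr 1; ring
      _ ≤ _ := (enorm_add_le _ _).trans (by gcongr)
  have h4 : ∫⁻ y in Q, ‖u y - ballAverage u y δ‖ₑ ∂(weightedMeasure w) ≤
      ENNReal.ofReal (ε / 4) * weightedMeasure w Q := by
    refine h1.trans ?_
    have h5 : weightedMeasure w Q ^ (1 - 1 / p) ≤ m ^ (-(1 / p)) * weightedMeasure w Q := by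
      rw [sub_eq_neg_add, ENNReal.rpow_add _ _ hQ0 hQt, ENNReal.rpow_one]
      refine mul_le_mul_left ?_ _
      rw [ENNReal.rpow_neg, ENNReal.rpow_neg, ENNReal.inv_le_inv]
      exact ENNReal.rpow_le_rpow (hmQ _ _ hi) hp1.le
    have h6 : ∫⁻ z in Metric.thickening δ Q, G z ^ p ∂(weightedMeasure w) ≤
        ∫⁻ z in (Metric.ball 0 R₂)ᶜ, G z ^ p ∂(weightedMeasure w) := by
      refine lintegral_mono_set fun z hz => ?_
      obtain ⟨y, hy, hzy⟩ := Metric.mem_thickening_iff.1 hz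
      have h7 := (le_max_right _ _).trans ((le_max_left _ _).trans (hfar y hy))
      rw [dist_eq_norm] at hzy
      rw [mem_compl_iff, mem_ball_zero_iff, not_lt]
      have h8 : ‖y‖ ≤ ‖z‖ + ‖z - y‖ := by
        calc ‖y‖ = ‖z - (z - y)‖ := by congr 1; abel
          _ ≤ _ := norm_sub_le _ _
      linarith
    calc _ ≤ C * (m ^ (-(1 / p)) * weightedMeasure w Q) *
          (∫⁻ z in (Metric.ball 0 R₂)ᶜ, G z ^ p ∂(weightedMeasure w)) ^ (1 / p) := by
          gcongr
      _ = (C * m ^ (-(1 / p)) * (∫⁻ z in (Metric.ball 0 R₂)ᶜ, G z ^ p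
          ∂(weightedMeasure w)) ^ (1 / p)) * weightedMeasure w Q := by ring
      _ ≤ _ := mul_le_mul_left hR₂ _
  have h9 := (enorm_setAverage_sub_mul_le hQ0 hQt (huK Q (isCompact_cube _ _)) c).trans
    (h2.trans (add_le_add_left h4 _))
  rw [← add_mul, ENNReal.mul_le_mul_iff_left hQ0 hQt, ← ENNReal.ofReal_add (by positivity)
    (by positivity), ← edist_eq_enorm_sub, edist_le_ofReal (by positivity)] at h9
  linarith

end

/-! ### Radial limits -/

section

variable {d : ℕ} {p : ℝ} {w u : EuclideanSpace ℝ (Fin d) → ℝ}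
  {G : EuclideanSpace ℝ (Fin d) → ℝ≥0∞}

/-- The integral of `H` along the ray from the origin through `y`, as a function on the whole space
that is positively homogeneous of degree `0`. -/
noncomputable def radialIntegral (H : EuclideanSpace ℝ (Fin d) → ℝ≥0∞)
    (y : EuclideanSpace ℝ (Fin d)) : ℝ≥0∞ :=
  ∫⁻ s in Ioi (0 : ℝ), H (s • y) * ‖y‖ₑ

theorem measurable_radialIntegral {H : EuclideanSpace ℝ (Fin d) → ℝ≥0∞} (hH : Measurable H) :
    Measurable (radialIntegral H) := by
  have : Measurable fun q : EuclideanSpace ℝ (Fin d) × ℝ => H (q.2 • q.1) * ‖q.1‖ₑ :=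
    (hH.comp (by fun_prop)).mul (by fun_prop)
  exact this.lintegral_prod_right'

theorem radialIntegral_smul (H : EuclideanSpace ℝ (Fin d) → ℝ≥0∞) (y : EuclideanSpace ℝ (Fin d))
    {t : ℝ} (ht : 0 < t) : radialIntegral H (t • y) = radialIntegral H y := by
  have h1 : (volume : Measure ℝ) =
      ENNReal.ofReal |t| • Measure.map (Homeomorph.mulRight₀ t ht.ne').toMeasurableEquiv volume :=
    (Real.smul_map_volume_mul_right ht.ne').symm
  have h2 : ∫⁻ s, (Ioi (0 : ℝ)).indicator (fun s => H (s • y) * ‖y‖ₑ) s =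
      ENNReal.ofReal |t| *
        ∫⁻ s, (Ioi (0 : ℝ)).indicator (fun s => H (s • y) * ‖y‖ₑ) (s * t) := by
    nth_rewrite 1 [h1]
    rw [lintegral_smul_measure, lintegral_map_equiv]
    rfl
  rw [radialIntegral, radialIntegral, ← lintegral_indicator measurableSet_Ioi,
    ← lintegral_indicator measurableSet_Ioi, h2, ← lintegral_const_mul' _ _ ENNReal.ofReal_ne_top]
  refine lintegral_congr fun s => ?_
  by_cases hs : 0 < s
  · have hst : 0 < s * t := mul_pos hs ht
    rw [indicator_of_mem (mem_Ioi.2 hs), indicator_of_mem (mem_Ioi.2 hst), smul_smul, enorm_smul,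
      Real.enorm_of_nonneg ht.le, abs_of_pos ht]
    ring
  · have hst : ¬ 0 < s * t := by
      rw [mul_pos_iff_of_pos_right ht]; exact hs
    rw [indicator_of_notMem (by simpa using hs), indicator_of_notMem (by simpa using hst), mul_zero]

theorem smul_mem_ball_iff {y x : EuclideanSpace ℝ (Fin d)} {r s : ℝ} (hs : 0 < s) :
    s • y ∈ Metric.ball (s • x) (s * r) ↔ y ∈ Metric.ball x r := by
  simpa using dilation_mem_ball_iff (z := 0) (x := x) (y := y) (r := r) hs

theorem setLIntegral_ball_comp_smul (F : EuclideanSpace ℝ (Fin d) → ℝ≥0∞)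
    (x : EuclideanSpace ℝ (Fin d)) (r : ℝ) {s : ℝ} (hs : 0 < s) :
    ∫⁻ y in Metric.ball x r, F (s • y) =
      ENNReal.ofReal ((s ^ d)⁻¹) * ∫⁻ y in Metric.ball (s • x) (s * r), F y := by
  have h1 := lintegral_comp_dilation ((Metric.ball (s • x) (s * r)).indicator F) 0 hs
  simp only [sub_zero, zero_add] at h1
  rw [← lintegral_indicator measurableSet_ball, ← lintegral_indicator measurableSet_ball, ← h1]
  refine lintegral_congr fun y => ?_
  by_cases hy : y ∈ Metric.ball x r
  · rw [indicator_of_mem hy, indicator_of_mem ((smul_mem_ball_iff hs).2 hy)]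
  · rw [indicator_of_notMem hy, indicator_of_notMem (mt (smul_mem_ball_iff hs).1 hy)]

theorem setLIntegral_radialIntegral_div_smul (H : EuclideanSpace ℝ (Fin d) → ℝ≥0∞)
    (x : EuclideanSpace ℝ (Fin d)) (r : ℝ) {s : ℝ} (hs : 0 < s) :
    (∫⁻ y in Metric.ball (s • x) (s * r), radialIntegral H y) /
        volume (Metric.ball (s • x) (s * r)) =
      (∫⁻ y in Metric.ball x r, radialIntegral H y) / volume (Metric.ball x r) := by
  have h1 := setLIntegral_ball_comp_smul (radialIntegral H) x r hs
  simp_rw [radialIntegral_smul H _ hs] at h1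
  have h0 : ENNReal.ofReal (s ^ d) ≠ 0 := by
    rw [Ne, ENNReal.ofReal_eq_zero, not_le]; positivity
  rw [h1, volume_ball_mul _ x hs, ENNReal.ofReal_inv_of_pos (by positivity), div_eq_mul_inv,
    div_eq_mul_inv, ENNReal.mul_inv (Or.inl h0) (Or.inl ENNReal.ofReal_ne_top)]
  ring

/-- Where the gradient is integrated only outside the unit ball, its integrals along rays are finite
for almost all rays: this is the step that needs `p < d`. -/
theorem setLIntegral_radialIntegral_lt_top (hp : 1 ≤ p) (hpd : p < d) (hw : IsMuckenhoupt p w)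
    (h : 0 < ⨅ x, weightedMeasure w (cube x 1)) (hGm : Measurable G)
    (hG : ∫⁻ x, G x ^ p ∂(weightedMeasure w) < ⊤) :
    ∫⁻ y in Metric.ball (0 : EuclideanSpace ℝ (Fin d)) 1,
      radialIntegral ({z | 1 < ‖z‖}.indicator G) y < ⊤ := by
  obtain ⟨C, hC⟩ := hw.exists_setLIntegral_le hp h one_pos
  have hp0 : 0 < p := by linarith
  have hp1 : 0 < 1 / p := by positivity
  have hS : MeasurableSet {z : EuclideanSpace ℝ (Fin d) | 1 < ‖z‖} :=
    measurableSet_lt measurable_const measurable_norm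
  set H := {z : EuclideanSpace ℝ (Fin d) | 1 < ‖z‖}.indicator G with hH
  have hHm : Measurable H := hGm.indicator hS
  set N := (∫⁻ x, G x ^ p ∂(weightedMeasure w)) ^ (1 / p) with hN
  have hNtop : N ≠ ⊤ := ENNReal.rpow_ne_top_of_nonneg hp1.le hG.ne
  have hm : Measurable fun q : EuclideanSpace ℝ (Fin d) × ℝ => H (q.2 • q.1) * ‖q.1‖ₑ :=
    (hHm.comp (by fun_prop)).mul (by fun_prop)
  have hsw := lintegral_lintegral_swap
    (μ := volume.restrict (Metric.ball (0 : EuclideanSpace ℝ (Fin d)) 1))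
    (ν := volume.restrict (Ioi (0 : ℝ))) (f := fun y s => H (s • y) * ‖y‖ₑ) hm.aemeasurable
  have hint : IntegrableOn (fun s : ℝ => s ^ (-(d / p) : ℝ)) (Ioi 1) :=
    integrableOn_Ioi_rpow_of_lt (by rw [neg_lt_neg_iff, one_lt_div hp0]; exact hpd) one_pos
  calc ∫⁻ y in Metric.ball (0 : EuclideanSpace ℝ (Fin d)) 1, radialIntegral H y
      = ∫⁻ s in Ioi (0 : ℝ), ∫⁻ y in Metric.ball (0 : EuclideanSpace ℝ (Fin d)) 1,
          H (s • y) * ‖y‖ₑ := hsw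
    _ ≤ ∫⁻ s in Ioi (0 : ℝ), (Ioi 1).indicator
          (fun s : ℝ => C * N * ENNReal.ofReal (s ^ (-(d / p) : ℝ))) s := by
        refine setLIntegral_mono' measurableSet_Ioi fun s hs => ?_
        have hs0 : 0 < s := hs
        by_cases hs1 : 1 < s
        · rw [indicator_of_mem (mem_Ioi.2 hs1)]
          calc _ ≤ ∫⁻ y in Metric.ball (0 : EuclideanSpace ℝ (Fin d)) 1, G (s • y) := by
                refine setLIntegral_mono' measurableSet_ball fun y hy => ?_
                have h1 : ‖y‖ₑ ≤ 1 := by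
                  rw [← ofReal_norm, ENNReal.ofReal_le_one]
                  exact (mem_ball_zero_iff.1 hy).le
                calc _ ≤ G (s • y) * 1 := by
                      gcongr
                      exact indicator_le_self _ _ _
                  _ = _ := mul_one _
            _ = ENNReal.ofReal ((s ^ d)⁻¹) *
                ∫⁻ y in Metric.ball (0 : EuclideanSpace ℝ (Fin d)) s, G y := by
                rw [setLIntegral_ball_comp_smul G _ _ hs0, smul_zero, mul_one]
            _ ≤ ENNReal.ofReal ((s ^ d)⁻¹) * (C * ENNReal.ofReal (s ^ (d - d / p)) * N) := by
                gcongr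
                refine (hC 0 s hs1.le G hGm.aemeasurable).trans ?_
                refine mul_le_mul_right (ENNReal.rpow_le_rpow ?_ hp1.le) _
                exact setLIntegral_le_lintegral _ _
            _ = C * N * (ENNReal.ofReal ((s ^ d)⁻¹) * ENNReal.ofReal (s ^ (d - d / p))) := by ring
            _ = _ := by
                rw [← ENNReal.ofReal_mul (by positivity), ← Real.rpow_natCast,
                  ← Real.rpow_neg hs0.le, ← Real.rpow_add hs0]
                congr 3
                ring
        · rw [indicator_of_notMem (by simpa using hs1)]
          refine le_of_eq (setLIntegral_eq_zero measurableSet_ball fun y hy => ?_)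
          have h1 : s • y ∉ {z : EuclideanSpace ℝ (Fin d) | 1 < ‖z‖} := by
            have h2 := mem_ball_zero_iff.1 hy
            have h3 : ‖s • y‖ ≤ 1 := by
              rw [norm_smul, Real.norm_of_nonneg hs0.le]
              nlinarith [norm_nonneg y, not_lt.1 hs1]
            simpa using h3
          simp only [hH, indicator_of_notMem h1, zero_mul, Pi.zero_apply]
    _ ≤ ∫⁻ s in Ioi (1 : ℝ), C * N * ENNReal.ofReal (s ^ (-(d / p) : ℝ)) := by
        rw [← lintegral_indicator (measurableSet_Ioi (a := (1 : ℝ)))]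
        exact setLIntegral_le_lintegral _ _
    _ < ⊤ := by
        rw [lintegral_const_mul' _ _ (ENNReal.mul_ne_top ENNReal.coe_ne_top hNtop)]
        exact ENNReal.mul_lt_top (ENNReal.mul_lt_top ENNReal.coe_lt_top hNtop.lt_top)
          hint.lintegral_lt_top

/-- The averages of `u` differ from the limit at infinity by at most the average of the radial
integrals of the gradient. -/
theorem DilationBound.enorm_ballAverage_sub_le (hD : DilationBound u G) {c : ℝ}
    {x : EuclideanSpace ℝ (Fin d)} {r T : ℝ} (hr : 0 < r) (hx : T + r ≤ ‖x‖)
    (hc : Tendsto (fun k : ℕ => ballAverage u ((2 : ℝ) ^ k • x) (2 ^ k * r)) atTop (𝓝 c)) :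
    ‖ballAverage u x r - c‖ₑ ≤ (∫⁻ y in Metric.ball x r,
      radialIntegral ({z | T < ‖z‖}.indicator G) y) / volume (Metric.ball x r) := by
  have hV0 : volume (Metric.ball x r) ≠ 0 := (Metric.measure_ball_pos volume x hr).ne'
  have hV : volume (Metric.ball x r) ≠ ⊤ := measure_ball_lt_top.ne
  refine le_of_tendsto ((tendsto_const_nhds.sub hc).enorm) (Eventually.of_forall fun k => ?_)
  have h1 := hD.bound 0 x r (2 ^ k) hr (one_le_pow₀ one_le_two)
  simp only [sub_zero, zero_add] at h1
  rw [ENNReal.le_div_iff_mul_le (Or.inl hV0) (Or.inl hV)]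
  refine h1.trans (setLIntegral_mono' measurableSet_ball fun y hy => ?_)
  have hy1 : T < ‖y‖ := by
    rw [Metric.mem_ball, dist_eq_norm] at hy
    have : ‖x‖ ≤ ‖y‖ + ‖y - x‖ := by
      calc ‖x‖ = ‖y - (y - x)‖ := by congr 1; abel
        _ ≤ _ := norm_sub_le _ _
    linarith
  calc _ ≤ ∫⁻ s in Ioc (1 : ℝ) (2 ^ k), {z | T < ‖z‖}.indicator G (s • y) * ‖y‖ₑ := by
        refine setLIntegral_mono' measurableSet_Ioc fun s hs => ?_
        have h2 : s • y ∈ {z : EuclideanSpace ℝ (Fin d) | T < ‖z‖} := by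
          have : ‖y‖ ≤ ‖s • y‖ := by
            rw [norm_smul, Real.norm_of_nonneg (by linarith [hs.1])]
            exact le_mul_of_one_le_left (norm_nonneg _) hs.1.le
          exact hy1.trans_le this
        rw [indicator_of_mem h2]
    _ ≤ _ := lintegral_mono_set fun s hs => lt_trans one_pos hs.1

theorem tendsto_radialIntegral_indicator (hG : Measurable G) {y : EuclideanSpace ℝ (Fin d)}
    (hy : radialIntegral ({z | 1 < ‖z‖}.indicator G) y ≠ ⊤) :
    Tendsto (fun n : ℕ => radialIntegral ({z | (n + 1 : ℝ) < ‖z‖}.indicator G) y) atTop (𝓝 0) := by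
  have hS (T : ℝ) : MeasurableSet {z : EuclideanSpace ℝ (Fin d) | T < ‖z‖} :=
    measurableSet_lt measurable_const measurable_norm
  have h1 := tendsto_lintegral_of_dominated_convergence (μ := volume.restrict (Ioi (0 : ℝ)))
    (F := fun (n : ℕ) s => {z | (n + 1 : ℝ) < ‖z‖}.indicator G (s • y) * ‖y‖ₑ) (f := 0)
    (fun s => {z | 1 < ‖z‖}.indicator G (s • y) * ‖y‖ₑ)
    (fun n => ((hG.indicator (hS _)).comp (by fun_prop)).mul_const _)
    (fun n => Eventually.of_forall fun s => ?_) hy (Eventually.of_forall fun s => ?_)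
  · simpa [radialIntegral] using h1
  · refine mul_le_mul_left (indicator_le_indicator_of_subset (fun z hz => ?_)
      (fun _ => zero_le) _) _
    have : (1 : ℝ) ≤ n + 1 := by linarith [Nat.cast_nonneg (α := ℝ) n]
    exact lt_of_le_of_lt this hz
  · obtain ⟨N, hN⟩ := exists_nat_ge ‖s • y‖
    refine tendsto_const_nhds.congr' ?_
    filter_upwards [eventually_ge_atTop N] with n hn
    have : s • y ∉ {z : EuclideanSpace ℝ (Fin d) | (n + 1 : ℝ) < ‖z‖} := by
      have : (N : ℝ) ≤ n := by exact_mod_cast hn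
      simp only [mem_ofPred_eq, not_lt]
      linarith
    simp [indicator_of_notMem this]

/-- A property that holds almost everywhere holds, on almost every ray, at some point of the open
unit ball. -/
theorem ae_toSphere_exists_of_ae {P : EuclideanSpace ℝ (Fin d) → Prop}
    (hP : ∀ᵐ y, P y) :
    ∀ᵐ ξ : Metric.sphere (0 : EuclideanSpace ℝ (Fin d)) 1
      ∂(volume : Measure (EuclideanSpace ℝ (Fin d))).toSphere,
      ∃ τ : ℝ, 0 < τ ∧ τ < 1 ∧ P (τ • (ξ : EuclideanSpace ℝ (Fin d))) := by
  have hmp :=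
    (volume : Measure (EuclideanSpace ℝ (Fin d))).measurePreserving_homeomorphUnitSphereProd
  have h1 : ∀ᵐ y : ({0}ᶜ : Set (EuclideanSpace ℝ (Fin d)))
      ∂(Measure.comap Subtype.val volume), P y := by
    rw [ae_iff, (MeasurableEmbedding.subtype_coe (measurableSet_singleton _).compl).comap_apply]
    refine measure_mono_null ?_ hP
    rintro _ ⟨y, hy, rfl⟩
    exact hy
  have hmp' := MeasurePreserving.symm
    (homeomorphUnitSphereProd (EuclideanSpace ℝ (Fin d))).toMeasurableEquiv hmp
  have h2 := Measure.ae_ae_of_ae_prod (hmp'.quasiMeasurePreserving.ae h1)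
  filter_upwards [h2] with ξ hξ
  by_contra hcon
  push Not at hcon
  have h3 : (Measure.volumeIoiPow (Module.finrank ℝ (EuclideanSpace ℝ (Fin d)) - 1))
      (Iio ⟨1, mem_Ioi.2 one_pos⟩) = 0 := by
    refine measure_mono_null (fun r hr => ?_) hξ
    have h4 := hcon r r.2 hr
    simpa using h4
  rw [Measure.volumeIoiPow_apply_Iio] at h3
  simp at h3
  linarith

/-- Almost every ray contains a Lebesgue point of all the radial integrals of the gradient, and
these bound the oscillation of `u` along the whole ray. -/
theorem DilationBound.hasRadialLimit (hD : DilationBound u G) (hp : 1 ≤ p) (hpd : p < d)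
    (hw : IsMuckenhoupt p w) (h : 0 < ⨅ x, weightedMeasure w (cube x 1))
    (hG : ∫⁻ x, G x ^ p ∂(weightedMeasure w) < ⊤) {c : ℝ}
    (hc : ∀ (x : ℕ → EuclideanSpace ℝ (Fin d)) (ρ L : ℝ), 0 < ρ → (∀ k, ‖x k‖ ≤ 2 ^ k * L) →
      Tendsto (fun k => ballAverage u (x k) (2 ^ k * ρ)) atTop (𝓝 c)) :
    HasRadialLimit u c := by
  have hS (T : ℝ) : MeasurableSet {z : EuclideanSpace ℝ (Fin d) | T < ‖z‖} :=
    measurableSet_lt measurable_const measurable_norm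
  -- `F n` integrates the gradient along the part of a ray outside the ball of radius `n + 1`
  set F : ℕ → EuclideanSpace ℝ (Fin d) → ℝ≥0∞ := fun n =>
    radialIntegral ({z | (n + 1 : ℝ) < ‖z‖}.indicator G) with hF
  have hFm (n) : Measurable (F n) := measurable_radialIntegral (hD.measurable.indicator (hS _))
  set B : Set (EuclideanSpace ℝ (Fin d)) := Metric.ball 0 1 with hB
  have hfin := setLIntegral_radialIntegral_lt_top hp hpd hw h hD.measurable hG
  have hF01 : F 0 = radialIntegral ({z | 1 < ‖z‖}.indicator G) := by simp [hF]
  have hF0 (n) (y) : F n y ≤ F 0 y := by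
    refine lintegral_mono fun s => mul_le_mul_left (indicator_le_indicator_of_subset
      (fun z hz => ?_) (fun _ => zero_le) _) _
    have : ((0 : ℕ) : ℝ) + 1 ≤ n + 1 := by simp
    exact lt_of_le_of_lt this hz
  have hint (n) : ∫⁻ y, B.indicator (F n) y ≠ ⊤ := by
    rw [lintegral_indicator measurableSet_ball]
    refine ((lintegral_mono (hF0 n)).trans_lt ?_).ne
    rw [hF01]
    exact hfin
  -- the Lebesgue differentiation theorem is applied on the unit ball only, where `F n` is
  -- integrable; homogeneity carries the result to the rest of each ray
  have hleb : ∀ᵐ y, ∀ n, Tendsto (fun a => (∫⁻ z in a, B.indicator (F n) z) / volume a)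
      ((Besicovitch.vitaliFamily volume).filterAt y) (𝓝 (B.indicator (F n) y)) :=
    ae_all_iff.2 fun n => VitaliFamily.ae_tendsto_lintegral_div _
      ((hFm n).indicator measurableSet_ball).aemeasurable (hint n)
  have hlt : ∀ᵐ y, B.indicator (F 0) y < ⊤ :=
    ae_lt_top ((hFm 0).indicator measurableSet_ball) (hint 0)
  refine (ae_toSphere_exists_of_ae (hleb.and hlt)).mono ?_
  rintro ξ ⟨τ, hτ0, hτ1, hτleb, hτlt⟩
  have hξ : ‖(ξ : EuclideanSpace ℝ (Fin d))‖ = 1 := by simp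
  set y₀ : EuclideanSpace ℝ (Fin d) := τ • (ξ : EuclideanSpace ℝ (Fin d)) with hy₀
  have hy₀n : ‖y₀‖ = τ := by
    rw [hy₀, norm_smul, hξ, mul_one, Real.norm_of_nonneg hτ0.le]
  have hy₀B : y₀ ∈ B := by rw [hB, mem_ball_zero_iff, hy₀n]; exact hτ1
  rw [indicator_of_mem hy₀B] at hτlt
  -- averages of `F n` over small balls about `y₀`
  have havg (n) : Tendsto (fun r => (∫⁻ z in Metric.ball y₀ r, F n z) /
      volume (Metric.ball y₀ r)) (𝓝[>] 0) (𝓝 (F n y₀)) := by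
    have h1 := (hτleb n).comp (Besicovitch.tendsto_filterAt volume y₀)
    rw [indicator_of_mem hy₀B] at h1
    refine h1.congr' ?_
    have h2 : ∀ᶠ r : ℝ in 𝓝[>] 0, r < 1 - τ :=
      nhdsWithin_le_nhds (eventually_lt_nhds (by linarith))
    filter_upwards [h2, self_mem_nhdsWithin] with r hr hr0
    have hr0' : (0 : ℝ) < r := hr0
    have h3 := ball_ae_eq_closedBall y₀ hr0'.ne'
    simp only [Function.comp]
    rw [← measure_congr h3, ← setLIntegral_congr h3]
    congr 1
    refine setLIntegral_congr_fun measurableSet_ball fun z hz => ?_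
    refine indicator_of_mem ?_ _
    rw [hB, mem_ball_zero_iff]
    have h4 := norm_sub_le_of_mem_ball (z := 0) hz (le_of_eq (by rw [sub_zero]))
    rw [sub_zero, hy₀n] at h4
    linarith
  have hF0lim : Tendsto (fun n => F n y₀) atTop (𝓝 0) :=
    tendsto_radialIntegral_indicator hD.measurable (by rw [← hF01]; exact hτlt.ne)
  have hmain : ∀ ε > 0, ∀ᶠ t : ℝ in atTop, ∀ᶠ r : ℝ in 𝓝[>] 0,
      |ballAverage u (t • (ξ : EuclideanSpace ℝ (Fin d))) r - c| ≤ ε := by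
    intro ε hε
    have hε' : (0 : ℝ≥0∞) < ENNReal.ofReal ε := by simpa using hε
    obtain ⟨n, hn⟩ := (hF0lim.eventually (eventually_lt_nhds hε')).exists
    filter_upwards [eventually_gt_atTop (n + 1 : ℝ)] with t ht
    have ht0 : 0 < t := by linarith [Nat.cast_nonneg (α := ℝ) n]
    have hs0 : 0 < t / τ := by positivity
    have h1 : Tendsto (fun r : ℝ => r / (t / τ)) (𝓝[>] 0) (𝓝[>] 0) := by
      refine tendsto_nhdsWithin_iff.2 ⟨?_, ?_⟩
      · refine Tendsto.mono_left ?_ nhdsWithin_le_nhds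
        exact Continuous.tendsto' (by fun_prop) _ _ (by simp)
      · filter_upwards [self_mem_nhdsWithin] with r hr
        exact div_pos hr hs0
    have h2 : ∀ᶠ r : ℝ in 𝓝[>] 0, r < t - (n + 1) :=
      nhdsWithin_le_nhds (eventually_lt_nhds (by linarith))
    filter_upwards [h1.eventually ((havg n).eventually (eventually_lt_nhds hn)), h2,
      self_mem_nhdsWithin] with r hr hr1 hr0
    have hr0' : (0 : ℝ) < r := hr0
    set x : EuclideanSpace ℝ (Fin d) := t • (ξ : EuclideanSpace ℝ (Fin d)) with hx
    have hxn : ‖x‖ = t := by rw [hx, norm_smul, hξ, mul_one, Real.norm_of_nonneg ht0.le]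
    have h3 := hD.enorm_ballAverage_sub_le (c := c) (x := x) (T := n + 1) hr0'
      (by rw [hxn]; linarith) (hc (fun k => (2 : ℝ) ^ k • x) r ‖x‖ hr0' fun k => by
        rw [norm_smul, Real.norm_of_nonneg (by positivity)])
    have h4 : (t / τ) • y₀ = x := by
      rw [hy₀, smul_smul, hx]; congr 1; field_simp
    have h5 : t / τ * (r / (t / τ)) = r := by field_simp
    -- the ball `B(x, r)` is a dilate of a small ball about `y₀`, with the same average of `F n`
    have h6 := setLIntegral_radialIntegral_div_smul
      ({z | (n + 1 : ℝ) < ‖z‖}.indicator G) y₀ (r / (t / τ)) hs0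
    rw [h4, h5] at h6
    rw [h6, ← ofReal_norm] at h3
    exact (ENNReal.ofReal_le_ofReal_iff hε.le).1 (h3.trans hr.le)
  have hrep : ∀ ε > 0, ∀ᶠ t : ℝ in atTop,
      ((c - ε : ℝ) : EReal) ≤ lebesgueRep u (t • (ξ : EuclideanSpace ℝ (Fin d))) ∧
        lebesgueRep u (t • (ξ : EuclideanSpace ℝ (Fin d))) ≤ ((c + ε : ℝ) : EReal) := by
    intro ε hε
    filter_upwards [hmain ε hε] with t ht
    constructor
    · refine le_limsup_of_frequently_le' (Eventually.frequently ?_)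
      filter_upwards [ht] with r hr
      have := abs_le.1 hr
      exact EReal.coe_le_coe_iff.2 (show c - ε ≤ ballAverage u _ r by linarith [this.1])
    · refine limsup_le_of_le isCobounded_le_of_bot ?_
      filter_upwards [ht] with r hr
      have := abs_le.1 hr
      exact EReal.coe_le_coe_iff.2 (show ballAverage u _ r ≤ c + ε by linarith [this.2])
  refine tendsto_order.2 ⟨fun a ha => ?_, fun a ha => ?_⟩
  · obtain ⟨q, hq1, hq2⟩ := EReal.lt_iff_exists_real_btwn.1 ha
    have hq : q < c := EReal.coe_lt_coe_iff.1 hq2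
    filter_upwards [hrep (c - q) (by linarith)] with t ht
    rw [sub_sub_cancel] at ht
    exact hq1.trans_le ht.1
  · obtain ⟨q, hq1, hq2⟩ := EReal.lt_iff_exists_real_btwn.1 ha
    have hq : c < q := EReal.coe_lt_coe_iff.1 hq1
    filter_upwards [hrep (q - c) (by linarith)] with t ht
    rw [add_sub_cancel] at ht
    exact ht.2.trans_lt hq2

end

/-! ### Necessity of the lower bound on unit cubes -/

section

variable {d : ℕ} {p : ℝ} {w u : EuclideanSpace ℝ (Fin d) → ℝ}

theorem hasWeakGradient_gradient (hu : ContDiff ℝ ∞ u) : HasWeakGradient u (gradient u) := by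
  have hu1 : ContDiff ℝ 1 u := hu.of_le (by exact_mod_cast le_top)
  have hcont : Continuous (gradient u) :=
    (InnerProductSpace.toDual ℝ (EuclideanSpace ℝ (Fin d))).symm.continuous.comp
      (hu1.continuous_fderiv one_ne_zero)
  refine ⟨hu.continuous.locallyIntegrable, hcont.locallyIntegrable, fun φ hφ hc i => ?_⟩
  have hφ1 : ContDiff ℝ 1 φ := hφ.of_le (by exact_mod_cast le_top)
  have e1 (x) : gradient u x i = fderiv ℝ u x (EuclideanSpace.single i 1) := by
    have h1 : inner ℝ (gradient u x) (EuclideanSpace.single i (1 : ℝ)) =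
        fderiv ℝ u x (EuclideanSpace.single i 1) := by
      rw [gradient, InnerProductSpace.toDual_symm_apply]
    rw [← h1]
    generalize gradient u x = v
    simp [EuclideanSpace.inner_single_right]
  simp_rw [e1]
  have hdu : Continuous fun x => fderiv ℝ u x (EuclideanSpace.single i 1) :=
    (hu1.continuous_fderiv one_ne_zero).clm_apply continuous_const
  have hdφ : Continuous fun x => fderiv ℝ φ x (EuclideanSpace.single i 1) :=
    (hφ1.continuous_fderiv one_ne_zero).clm_apply continuous_const
  refine integral_mul_fderiv_eq_neg_fderiv_mul_of_integrable ?_ ?_ ?_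
    (fun x _ => hu1.differentiable one_ne_zero x) (fun x _ => hφ1.differentiable one_ne_zero x)
  · exact (hdu.mul hφ.continuous).integrable_of_hasCompactSupport hc.mul_left
  · exact (hu.continuous.mul hdφ).integrable_of_hasCompactSupport
      (hc.fderiv_apply (𝕜 := ℝ) _).mul_left
  · exact (hu.continuous.mul hφ.continuous).integrable_of_hasCompactSupport hc.mul_left

theorem tendstoInfinity_cube_one {v : ℕ → EuclideanSpace ℝ (Fin d)}
    (hv : Tendsto (fun n => ‖v n‖) atTop atTop) : TendstoInfinity fun n => cube (v n) 1 := by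
  intro R _
  obtain ⟨N, hN⟩ := eventually_atTop.1 (hv.eventually_ge_atTop (R + d))
  refine ⟨N, fun n hn => eq_empty_of_forall_notMem ?_⟩
  rintro y ⟨hy1, hy2⟩
  have h1 := dist_le_of_mem_cube zero_le_one hy2
  rw [mem_ball_zero_iff] at hy1
  have h2 := hN n hn
  have h3 := dist_triangle (v n) y 0
  rw [dist_zero_right, dist_zero_right, dist_comm] at h3
  have : (0 : ℝ) ≤ d := by positivity
  linarith

theorem HasCubeLimit.tendsto_cube_one {c : ℝ} (h : HasCubeLimit w u c)
    {v : ℕ → EuclideanSpace ℝ (Fin d)} (hv : Tendsto (fun n => ‖v n‖) atTop atTop) :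
    Tendsto (fun n => ⨍ y in cube (v n) 1, u y ∂(weightedMeasure w)) atTop (𝓝 c) :=
  h v (fun _ => 1) (fun _ => one_pos) (by simp) (tendstoInfinity_cube_one hv)

theorem HasCubeLimit.unique (hd : 0 < d) {c c' : ℝ} (h : HasCubeLimit w u c)
    (h' : HasCubeLimit w u c') : c = c' := by
  have hv : Tendsto (fun n : ℕ => ‖(EuclideanSpace.single (⟨0, hd⟩ : Fin d) (n : ℝ))‖)
      atTop atTop := by
    simpa using tendsto_natCast_atTop_atTop (R := ℝ)
  exact tendsto_nhds_unique (h.tendsto_cube_one hv) (h'.tendsto_cube_one hv)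

/-- If unit cubes have arbitrarily small mass, then they do so far away from the origin. -/
theorem IsMuckenhoupt.exists_measure_cube_lt (hp : 1 ≤ p) (hw : IsMuckenhoupt p w)
    (h : ⨅ x, weightedMeasure w (cube x 1) = 0) {ε : ℝ≥0∞} (hε : 0 < ε) {R : ℝ} (hR : 0 ≤ R) :
    ∃ x, R < ‖x‖ ∧ weightedMeasure w (cube x 1) < ε := by
  obtain ⟨C, hC⟩ := hw.exists_measure_ball_le hp (M := 2 * (R + 1)) (by positivity)
  set m := weightedMeasure w (Metric.ball 0 (R + 1)) / (C + 1 : ℝ≥0) with hm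
  have hm0 : 0 < m := ENNReal.div_pos (hw.measure_ball_pos 0 (by linarith)).ne' ENNReal.coe_ne_top
  obtain ⟨x, hx⟩ := iInf_lt_iff.1 (h.trans_lt (lt_min hε hm0))
  refine ⟨x, ?_, hx.trans_le (min_le_left _ _)⟩
  by_contra hxR
  rw [not_lt] at hxR
  have h1 : Metric.ball x (1 / 2) ⊆ Metric.ball 0 (2 * (R + 1) * (1 / 2)) := by
    refine Metric.ball_subset_ball' ?_
    rw [dist_zero_right]
    linarith
  have h2 := hC x 0 (1 / 2) (by norm_num) h1
  have h3 : 2 * (R + 1) * (1 / 2) = R + 1 := by ring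
  rw [h3] at h2
  refine (hx.trans_le (min_le_right _ _)).not_ge ?_
  rw [hm]
  refine ENNReal.div_le_of_le_mul' (h2.trans ?_)
  gcongr
  · simp
  · exact ball_subset_cube x 1

theorem ball_subset_ball_mul_half (x : EuclideanSpace ℝ (Fin d)) {a : ℝ} (ha : 1 ≤ a) :
    Metric.ball x (1 / 2) ⊆ Metric.ball x (a * (1 / 2)) :=
  Metric.ball_subset_ball (by linarith)

/-- If the masses of unit cubes are not bounded below, a sum of bumps that are supported near sparse
cubes of summable masses lies in the Sobolev space, and its averages over these cubes and over
other cubes have different limits. -/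
theorem IsMuckenhoupt.iInf_measure_cube_pos (hd : 0 < d) (hp : 1 ≤ p) (hw : IsMuckenhoupt p w)
    (H : ∀ u : EuclideanSpace ℝ (Fin d) → ℝ, MemHomSobolev p w u →
      ∃! c : ℝ, HasCubeLimit w u c) :
    0 < ⨅ x, weightedMeasure w (cube x 1) := by
  by_contra hcon
  have h0 : ⨅ x, weightedMeasure w (cube x 1) = 0 := by simpa using hcon
  have hp0 : 0 < p := by linarith
  -- `a` is the unit of length of the construction
  set a : ℝ := d + 1 with ha
  have hda : (d : ℝ) ≤ a := by linarith
  have ha1 : 1 ≤ a := by rw [ha]; linarith [Nat.cast_nonneg (α := ℝ) d]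
  have hfar (n : ℕ) (R : ℝ) : ∃ x, max R 0 < ‖x‖ ∧
      weightedMeasure w (cube x 1) < ENNReal.ofReal ((1 / 2) ^ n) :=
    hw.exists_measure_cube_lt hp h0 (by rw [ENNReal.ofReal_pos]; positivity) (le_max_right _ _)
  choose f hf1 hf2 using hfar
  set x : ℕ → EuclideanSpace ℝ (Fin d) :=
    fun n => Nat.rec (f 0 0) (fun n y => f (n + 1) (‖y‖ + 10 * a)) n with hx
  have hxs (n) : x (n + 1) = f (n + 1) (‖x n‖ + 10 * a) := rfl
  have hxμ (n) : weightedMeasure w (cube (x n) 1) ≤ ENNReal.ofReal ((1 / 2) ^ n) := by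
    cases n with
    | zero => exact (hf2 0 0).le
    | succ n => rw [hxs]; exact (hf2 _ _).le
  have hx0 (n) : 0 < ‖x n‖ := by
    cases n with
    | zero => exact (le_max_right _ _).trans_lt (hf1 0 0)
    | succ n => rw [hxs]; exact (le_max_right _ _).trans_lt (hf1 _ _)
  have hxstep (n) : ‖x n‖ + 10 * a ≤ ‖x (n + 1)‖ := by
    rw [hxs]; exact ((le_max_left _ _).trans_lt (hf1 _ _)).le
  have hxlt : ∀ m n, m < n → ‖x m‖ + 10 * a ≤ ‖x n‖ := by
    intro m n hmn
    induction n, hmn using Nat.le_induction with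
    | base => exact hxstep m
    | succ n _ ih => linarith [hxstep n]
  have hxge (n : ℕ) : (n : ℝ) ≤ ‖x n‖ := by
    induction n with
    | zero => simp
    | succ n ih => push_cast; linarith [hxstep n]
  have hxtop : Tendsto (fun n => ‖x n‖) atTop atTop :=
    tendsto_atTop_mono hxge tendsto_natCast_atTop_atTop
  have hxsep : ∀ m n, m ≠ n → 10 * a ≤ dist (x m) (x n) := by
    intro m n hmn
    rw [dist_eq_norm]
    rcases lt_or_gt_of_ne hmn with h | h
    · linarith [hxlt m n h, norm_sub_norm_le (x n) (x m), norm_sub_rev (x n) (x m)]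
    · linarith [hxlt n m h, norm_sub_norm_le (x m) (x n)]
  -- the bump equals `1` on the unit cube about the origin, which lies in the ball of radius `a`
  set φ : ContDiffBump (0 : EuclideanSpace ℝ (Fin d)) :=
    ⟨a, 2 * a, by linarith, by linarith⟩ with hφ
  have hφout : φ.rOut = 2 * a := rfl
  have hφin : φ.rIn = a := rfl
  set u : EuclideanSpace ℝ (Fin d) → ℝ := fun z => ∑' n, φ (z - x n) with hu
  have hφ0 (z : EuclideanSpace ℝ (Fin d)) (n) (h : 2 * a ≤ dist z (x n)) : φ (z - x n) = 0 :=
    φ.zero_of_le_dist (by rw [dist_zero_right, ← dist_eq_norm, hφout]; exact h)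
  have hu1 (z : EuclideanSpace ℝ (Fin d)) (m : ℕ) (h : dist z (x m) < 4 * a) :
      u z = φ (z - x m) := by
    refine tsum_eq_single m fun n hn => hφ0 z n ?_
    linarith [hxsep n m hn, dist_triangle (x n) z (x m), dist_comm z (x n)]
  have hu0 (z : EuclideanSpace ℝ (Fin d)) (h : ∀ n, 2 * a ≤ dist z (x n)) : u z = 0 := by
    rw [hu]
    simp only [fun n => hφ0 z n (h n), tsum_zero]
  -- near each point, `u` is one of the bumps or zero
  have hloc (y : EuclideanSpace ℝ (Fin d)) :
      (∃ m, dist y (x m) < 3 * a ∧ u =ᶠ[𝓝 y] fun z => φ (z - x m)) ∨ u =ᶠ[𝓝 y] fun _ => 0 := by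
    by_cases hy : ∃ m, dist y (x m) < 3 * a
    · obtain ⟨m, hm⟩ := hy
      refine Or.inl ⟨m, hm, ?_⟩
      filter_upwards [Metric.ball_mem_nhds y (show 0 < a by linarith)] with z hz
      rw [Metric.mem_ball] at hz
      exact hu1 z m (by linarith [dist_triangle z y (x m)])
    · push Not at hy
      refine Or.inr ?_
      filter_upwards [Metric.ball_mem_nhds y (show 0 < a by linarith)] with z hz
      rw [Metric.mem_ball, dist_comm] at hz
      exact hu0 z fun n => by linarith [dist_triangle y z (x n), hy n]
  have hφs (m) : ContDiff ℝ ∞ fun z => φ (z - x m) :=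
    φ.contDiff.comp (contDiff_id.sub contDiff_const)
  have hus : ContDiff ℝ ∞ u := by
    refine contDiff_iff_contDiffAt.2 fun y => ?_
    rcases hloc y with ⟨m, _, hm⟩ | hm
    · exact (hφs m).contDiffAt.congr_of_eventuallyEq hm
    · exact contDiffAt_const.congr_of_eventuallyEq hm
  have hub (y) : ‖u y‖ ≤ 1 := by
    rcases hloc y with ⟨m, _, hm⟩ | hm
    · rw [hm.eq_of_nhds, Real.norm_of_nonneg φ.nonneg]; exact φ.le_one
    · rw [hm.eq_of_nhds]; simp
  obtain ⟨M, hM⟩ := (φ.hasCompactSupport.fderiv (𝕜 := ℝ)).exists_bound_of_continuous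
    ((φ.contDiff (n := 1)).continuous_fderiv one_ne_zero)
  have hgn (y) : ‖gradient u y‖ = ‖fderiv ℝ u y‖ := by
    rw [gradient, LinearIsometryEquiv.norm_map]
  have hgrad (y) : ‖gradient u y‖ₑ ^ p ≤
      ∑' n, (Metric.ball (x n) (3 * a)).indicator (fun _ => ENNReal.ofReal M ^ p) y := by
    rcases hloc y with ⟨m, hm1, hm⟩ | hm
    · refine le_trans ?_ (ENNReal.le_tsum m)
      rw [indicator_of_mem (Metric.mem_ball.2 hm1), ← ofReal_norm, hgn, hm.fderiv_eq,
        fderiv_comp_sub]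
      exact ENNReal.rpow_le_rpow (ENNReal.ofReal_le_ofReal (hM _)) hp0.le
    · rw [← ofReal_norm, hgn, hm.fderiv_eq]
      simp [hp0]
  -- the enlarged supports have summable masses, because `μ` is doubling
  obtain ⟨C, hC⟩ := hw.exists_measure_ball_le hp (M := 6 * a) (by linarith)
  have hball (n) : weightedMeasure w (Metric.ball (x n) (3 * a)) ≤
      C * ENNReal.ofReal ((1 / 2) ^ n) := by
    have h1 := hC (x n) (x n) (1 / 2) (by norm_num) (ball_subset_ball_mul_half _ (by linarith))
    have h2 : 6 * a * (1 / 2) = 3 * a := by ring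
    rw [h2] at h1
    exact h1.trans (mul_le_mul_right ((measure_mono (ball_subset_cube _ _)).trans (hxμ n)) _)
  have hgint : ∫⁻ y, ‖gradient u y‖ₑ ^ p ∂(weightedMeasure w) < ⊤ := by
    calc _ ≤ ∫⁻ y, ∑' n, (Metric.ball (x n) (3 * a)).indicator
          (fun _ => ENNReal.ofReal M ^ p) y ∂(weightedMeasure w) := lintegral_mono hgrad
      _ = ∑' n, ENNReal.ofReal M ^ p * weightedMeasure w (Metric.ball (x n) (3 * a)) := by
          rw [lintegral_tsum fun n => (measurable_const.indicator measurableSet_ball).aemeasurable]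
          simp_rw [lintegral_indicator measurableSet_ball, setLIntegral_const]
      _ ≤ ∑' n : ℕ, ENNReal.ofReal M ^ p * (C * ENNReal.ofReal ((1 / 2) ^ n)) :=
          ENNReal.tsum_le_tsum fun n => mul_le_mul_right (hball n) _
      _ < ⊤ := by
          rw [ENNReal.tsum_mul_left, ENNReal.tsum_mul_left,
            ← ENNReal.ofReal_tsum_of_nonneg (fun n => by positivity) summable_geometric_two]
          exact ENNReal.mul_lt_top (ENNReal.rpow_lt_top_of_nonneg hp0.le ENNReal.ofReal_ne_top)
            (ENNReal.mul_lt_top ENNReal.coe_lt_top ENNReal.ofReal_lt_top)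
  have hwg := hasWeakGradient_gradient hus
  have hmem : MemHomSobolev p w u := by
    refine ⟨fun K hK => ?_, gradient u, hwg, ?_, ?_⟩
    · have : IsFiniteMeasure ((weightedMeasure w).restrict K) :=
        ⟨by simpa using hw.measure_lt_top hK.isBounded⟩
      exact MemLp.of_bound hus.continuous.aestronglyMeasurable 1 (Eventually.of_forall hub)
    · exact hwg.locallyIntegrable_grad.aestronglyMeasurable.mono_ac
        (weightedMeasure_absolutelyContinuous w)
    · rw [eLpNorm_lt_top_iff_lintegral_rpow_enorm_lt_top
        (by rw [Ne, ENNReal.ofReal_eq_zero]; linarith) ENNReal.ofReal_ne_top,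
        ENNReal.toReal_ofReal hp0.le]
      exact hgint
  obtain ⟨c, hc, -⟩ := H u hmem
  have hQ0 (y : EuclideanSpace ℝ (Fin d)) : weightedMeasure w (cube y 1) ≠ 0 :=
    ((hw.measure_ball_pos y (by norm_num)).trans_le (measure_mono (ball_subset_cube y 1))).ne'
  have hQt (y : EuclideanSpace ℝ (Fin d)) : weightedMeasure w (cube y 1) ≠ ⊤ :=
    (hw.measure_lt_top (isCompact_cube y 1).isBounded).ne
  have havg (y : EuclideanSpace ℝ (Fin d)) (b : ℝ) (h : ∀ z ∈ cube y 1, u z = b) :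
      ⨍ z in cube y 1, u z ∂(weightedMeasure w) = b := by
    rw [setAverage_eq, setIntegral_congr_fun (measurableSet_cube y 1) h, ← setAverage_eq,
      setAverage_const (hQ0 y) (hQt y)]
  have hdist {y z : EuclideanSpace ℝ (Fin d)} (h : z ∈ cube y 1) : dist z y ≤ a := by
    have := dist_le_of_mem_cube zero_le_one h
    linarith
  have hc1 : c = 1 := by
    refine tendsto_nhds_unique (hc.tendsto_cube_one hxtop) (tendsto_const_nhds.congr fun n => ?_)
    refine (havg (x n) 1 fun z hz => ?_).symm
    have h1 := hdist hz
    rw [hu1 z n (by linarith)]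
    refine φ.one_of_mem_closedBall ?_
    rw [mem_closedBall_zero_iff, ← dist_eq_norm, hφin]
    exact h1
  -- cubes half-way between the supports of two consecutive bumps
  set y : ℕ → EuclideanSpace ℝ (Fin d) := fun n => (1 + 5 * a / ‖x n‖) • x n with hy
  have hyn (n) : ‖y n‖ = ‖x n‖ + 5 * a := by
    have := hx0 n
    rw [hy, norm_smul, Real.norm_of_nonneg (by positivity), add_mul, one_mul,
      div_mul_cancel₀ _ this.ne']
  have hytop : Tendsto (fun n => ‖y n‖) atTop atTop :=
    tendsto_atTop_mono (fun n => by rw [hyn]; linarith) hxtop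
  have hc0 : c = 0 := by
    refine tendsto_nhds_unique (hc.tendsto_cube_one hytop) (tendsto_const_nhds.congr fun n => ?_)
    refine (havg (y n) 0 fun z hz => hu0 z fun m => ?_).symm
    have h1 := hdist hz
    have h2 : 5 * a ≤ dist (y n) (x m) := by
      rw [dist_eq_norm]
      rcases lt_trichotomy m n with h | h | h
      · linarith [hxlt m n h, hyn n, norm_sub_norm_le (y n) (x m)]
      · subst h
        linarith [hyn m, norm_sub_norm_le (y m) (x m)]
      · linarith [hxlt n m h, hyn n, norm_sub_norm_le (x m) (y n), norm_sub_rev (x m) (y n)]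
    linarith [dist_triangle (y n) z (x m), dist_comm (y n) z]
  linarith

end

end MuckenhouptLimits

theorem mainTheorem4 (d : ℕ) (hd : 2 ≤ d) (p : ℝ) (hp : 1 ≤ p) (hpd : p < d)
    (w : EuclideanSpace ℝ (Fin d) → ℝ) (hw : MuckenhouptLimits.IsMuckenhoupt p w) :
    ((0 < ⨅ x : EuclideanSpace ℝ (Fin d),
          MuckenhouptLimits.weightedMeasure w (MuckenhouptLimits.cube x 1)) ↔
      ∀ u : EuclideanSpace ℝ (Fin d) → ℝ, MuckenhouptLimits.MemHomSobolev p w u →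
        ∃! c : ℝ, MuckenhouptLimits.HasCubeLimit w u c) ∧
    ((0 < ⨅ x : EuclideanSpace ℝ (Fin d),
          MuckenhouptLimits.weightedMeasure w (MuckenhouptLimits.cube x 1)) →
      ∀ u : EuclideanSpace ℝ (Fin d) → ℝ, MuckenhouptLimits.MemHomSobolev p w u →
        ∀ c : ℝ, MuckenhouptLimits.HasCubeLimit w u c →
          MuckenhouptLimits.HasRadialLimit u c) := by
  have hd0 : 0 < d := by omega
  have key : (0 < ⨅ x, MuckenhouptLimits.weightedMeasure w (MuckenhouptLimits.cube x 1)) →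
      ∀ u, MuckenhouptLimits.MemHomSobolev p w u →
        ∃ c, MuckenhouptLimits.HasCubeLimit w u c ∧ MuckenhouptLimits.HasRadialLimit u c := by
    intro h u hu
    obtain ⟨G, hD, hG⟩ := hu.exists_dilationBound hp
    have hloc : LocallyIntegrable u volume := by
      obtain ⟨g, hg, -⟩ := hu.exists_grad
      exact hg.locallyIntegrable
    obtain ⟨c, hc1, hc2⟩ := hD.exists_tendsto_ballAverage hp hpd hw h hG
    exact ⟨c, hD.hasCubeLimit hp hw h hG hloc (fun K hK => hu.integrableOn hp hw hK) hc2,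
      hD.hasRadialLimit hp hpd hw h hG hc1⟩
  refine ⟨⟨fun h u hu => ?_, hw.iInf_measure_cube_pos hd0 hp⟩, fun h u hu c hc => ?_⟩
  · obtain ⟨c, hc, -⟩ := key h u hu
    exact ⟨c, hc, fun c' hc' => hc'.unique hd0 hc⟩
  · obtain ⟨c', hc', hr⟩ := key h u hu
    rwa [hc.unique hd0 hc']
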